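/- A \emph{nondeterministic discounted-sum automaton (NDA)} with discount factor $\lambda\in\mathbb{Q}\cap(1,\infty)$ (a $\lambda$-NDA) consists of a finite alphabet $\Sigma$, a finite set of states $Q$, a set of initial states $\iota\subseteq Q$, a transition relation $\delta\subseteq Q\times\Sigma\times Q$ and a weight function $\gamma:\delta\to\mathbb{Q}$. A run on an infinite word $w=\sigma_0\sigma_1\cdots\in\Sigma^\omega$ is a sequence of states $p_0,p_1,\dots$ with $p_0\in\iota$ and $(p_i,\sigma_i,p_{i+1})\in\delta$ for all $i$; its value is $\sum_{i\ge 0}\gamma(p_i,\sigma_i,p_{i+1})/\lambda^i$. The value $\mathcal{A}(w)$ of an NDA $\mathcal{A}$ on $w$ is the infimum of the values of its runs on $w$ (so $\mathcal{A}(w)=+\infty$ if there is no run on $w$). A $\lambda$-NDA is \emph{deterministic} (a $\lambda$-DDA) if $|\iota|=1$ and for every $q\in Q$ and $\sigma\in\Sigma$ there is at most one $q'$ with $(q,\sigma,q')\in\delta$. \textbf{Lemma.} There is an algorithm that, for every input consisting of discount factors $\lambda_A,\lambda_D\in\mathbb{Q}\cap(1,\infty)$, a $\lambda_A$-NDA $\mathcal{A}$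 and a $\lambda_D$-DDA $\mathcal{D}$ over a common alphabet $\Sigma$, computes the value of $$\min\{\mathcal{A}(w)-\mathcal{D}(w) : w\in\Sigma^\omega\}.$$ Here words $w$ with $\mathcal{A}(w)=\mathcal{D}(w)=+\infty$, for which the difference is undefined, are disregarded. If no word remains, the algorithm reports this; otherwise the minimum exists and is a rational number, $-\infty$ or $+\infty$. In particular, if $\Sigma\neq\emptyset$ and both automata have a run on every infinite word, then the minimum over all of $\Sigma^\omega$ exists, is rational, and is computed. -/

import Mathlib

/-- A nondeterministic discounted-sum automaton over the alphabet `α` with states `Q`.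
`weight q a q' = some c` says that `(q, a, q')` is a transition and `c` is its weight;
`weight q a q' = none` says that `(q, a, q')` is not a transition. -/
structure NDA (α Q : Type*) where
  init : Finset Q
  weight : Q → α → Q → Option ℚ
  factor : ℚ
  one_lt_factor : 1 < factor

namespace NDA

variable {α Q P : Type*}

/-- `(q, a, q')` is a transition of the automaton. -/
def Trans (A : NDA α Q) (q : Q) (a : α) (q' : Q) : Prop :=
  ∃ c, A.weight q a q' = some c

/-- One initial state, and at most one successor for every state and letter. -/
def IsDeterministic (A : NDA α Q) : Prop :=
  A.init.card = 1 ∧ ∀ q a q₁ q₂, A.Trans q a q₁ → A.Trans q a q₂ → q₁ = q₂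

/-- `r` is the sequence of states of an infinite run on the infinite word `w`. -/
def IsRun (A : NDA α Q) (w : ℕ → α) (r : ℕ → Q) : Prop :=
  r 0 ∈ A.init ∧ ∀ i, A.Trans (r i) (w i) (r (i + 1))

/-- The discounted sum of the weights along a run: the `i`-th weight is divided by the `i`-th
power of the discount factor. -/
noncomputable def runValue (A : NDA α Q) (w : ℕ → α) (r : ℕ → Q) : ℝ :=
  ∑' i, (((A.weight (r i) (w i) (r (i + 1))).getD 0 : ℚ) : ℝ) / (A.factor : ℝ) ^ i

/-- The value of an infinite word: the infimum of the values of the runs on it, which is `⊤` when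
there is no run on it. -/
noncomputable def value (A : NDA α Q) (w : ℕ → α) : EReal :=
  sInf {v : EReal | ∃ r, A.IsRun w r ∧ v = (A.runValue w r : EReal)}

/-- All values `A(w) - D(w)`, where `w` ranges over the infinite words; only the words for which
the difference would be the undefined expression `∞ - ∞` are skipped. -/
noncomputable def differences (A : NDA α Q) (D : NDA α P) : Set EReal :=
  {v : EReal | ∃ w : ℕ → α, ¬(A.value w = ⊤ ∧ D.value w = ⊤) ∧ v = A.value w - D.value w}

end NDA

/-- Finite descriptions of automata: the number of letters, the number of states, the discount
factor, the list of initial states, and the list of transitions with their weights. Rational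
numbers are given by numerator and denominator. -/
abbrev NDACode : Type :=
  ℕ × ℕ × (ℤ × ℕ) × List ℕ × List ((ℕ × ℕ × ℕ) × (ℤ × ℕ))

/-- The description of an automaton with letters `0, …, s - 1` and states `0, …, n - 1`. -/
def NDA.code {s n : ℕ} (A : NDA (Fin s) (Fin n)) : NDACode :=
  (s, n, (A.factor.num, A.factor.den),
    ((List.finRange n).filter fun q => q ∈ A.init).map fun q => (q : ℕ),
    (List.finRange n).flatMap fun q => (List.finRange s).flatMap fun a =>
      (List.finRange n).filterMap fun q' =>
        (A.weight q a q').map fun c => (((q : ℕ), (a : ℕ), (q' : ℕ)), (c.num, c.den)))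

/-- Possible answers: `none` (there is no value), `-∞`, `+∞`, or a fraction. -/
abbrev MinAnswer : Type := Option (Bool ⊕ (ℤ × ℕ))

/-- The answer describes the minimum of the set `S`. -/
def IsMinAnswer (S : Set EReal) : MinAnswer → Prop
  | none => S = ∅
  | some (Sum.inl false) => IsLeast S ⊥
  | some (Sum.inl true) => IsLeast S ⊤
  | some (Sum.inr (z, d)) => 0 < d ∧ IsLeast S (((z : ℝ) / (d : ℝ) : ℝ) : EReal)

/-!
The algorithm searches for a finite certificate of the answer. The certificates are lists of natural
numbers and fractions; verifying one is primitive recursive (`primrecPred_supports`), every input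
has one (`exists_supports`), and a certificate is right about the automata
(`NDA.isMinAnswer_of_supports`). Unbounded search then gives a total computable function
(`exists_computable_of_certificates`).

The infinite answers and the empty set are matters of reachability. If `A` has a run on a word
without a run of `D`, the minimum is `-∞`; since `D` is deterministic, this is seen from a finite
path to a pair of states where `A` can move on to a live state and `D` is stuck (`EscapeList`).
Otherwise `D` can follow all runs of `A`; if there is no run of `A`, the answer depends on whether
`D` has one.

In the remaining case, with `x` and `y` the inverses of the discount factors, the minimum is the
least cost `∑ c_k x ^ k - d_k y ^ k` of an infinite path in the product graph. If `y < x`, the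
second term loses influence over time. So from some time `K` on a path is optimal exactly if it is
optimal for the weights `c` and, among those paths, optimal for the weights `d`: leaving the edges
that are optimal for `c` costs a fixed gap times `x ^ k` and gains at most a constant times `y ^ k`
(`exists_lex_potentials`). The case `x < y` is symmetric, and for `x = y` the two weights are added
up. Both optima are attained by memoryless choices and are rational
(`exists_bellman`). Hence the least remaining cost at time `k ≥ K` in a node `s` is
`V s * x ^ k + W s * y ^ k` with rational `V` and `W`, and the costs at earlier times follow by
backward recursion (`exists_layered_potentials`).

Conversely, given such numbers for the layers `0, …, K`, it takes finitely many rational comparisons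
to check that no edge lets them drop by more than its cost and that some edge attains equality. In
the last layer an expression `a x ^ k + b y ^ k` has to be nonnegative for all `k ≥ K`, which
follows from the case `k = K` and the sign of the coefficient of the larger base (`RelAfter.le`). As the
potentials tend to zero, they then bound the cost of all paths (`potential_le_sum`), and an edge
with equality at every step leads to a path that attains the bound.
-/

/-! ### Primitive recursive predicates on lists and rational numbers -/

-- With these rules, `fun_prop` proves that compositions of projections, pairs and arithmetic on the
-- natural numbers are primitive recursive.
attribute [fun_prop] Primrec Primrec.const Primrec.comp Primrec.pair

namespace Primrec

variable {α β γ : Type*} [Primcodable α] [Primcodable β] [Primcodable γ]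

@[fun_prop] theorem fun_id : Primrec fun a : α => a := Primrec.id

@[fun_prop] theorem fun_fst {f : α → β × γ} (hf : Primrec f) : Primrec fun a => (f a).1 :=
  Primrec.fst.comp hf

@[fun_prop] theorem fun_snd {f : α → β × γ} (hf : Primrec f) : Primrec fun a => (f a).2 :=
  Primrec.snd.comp hf

@[fun_prop] theorem fun_add {f g : α → ℕ} (hf : Primrec f) (hg : Primrec g) :
    Primrec fun a => f a + g a :=
  Primrec.nat_add.comp hf hg

@[fun_prop] theorem fun_sub {f g : α → ℕ} (hf : Primrec f) (hg : Primrec g) :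
    Primrec fun a => f a - g a :=
  Primrec.nat_sub.comp hf hg

@[fun_prop] theorem fun_mul {f g : α → ℕ} (hf : Primrec f) (hg : Primrec g) :
    Primrec fun a => f a * g a :=
  Primrec.nat_mul.comp hf hg

@[fun_prop] theorem fun_min {f g : α → ℕ} (hf : Primrec f) (hg : Primrec g) :
    Primrec fun a => min (f a) (g a) :=
  Primrec.nat_min.comp hf hg

@[fun_prop] theorem fun_toNat {f : α → ℤ} (hf : Primrec f) : Primrec fun a => (f a).toNat := by
  have h : Primrec fun z : ℤ => if Encodable.encode z % 2 = 0 then Encodable.encode z / 2 else 0 :=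
    Primrec.ite (Primrec.eq.comp (Primrec.nat_mod.comp Primrec.encode (Primrec.const 2))
      (Primrec.const 0)) (Primrec.nat_div.comp Primrec.encode (Primrec.const 2)) (Primrec.const 0)
  refine (h.of_eq fun z => ?_).comp hf
  cases z with
  | ofNat n =>
    have : Encodable.encode (Int.ofNat n) = 2 * n := rfl
    rw [this]
    simp
  | negSucc n =>
    have : Encodable.encode (Int.negSucc n) = 2 * n + 1 := rfl
    rw [this, if_neg (by omega)]
    rfl

@[fun_prop] theorem fun_toNat_neg {f : α → ℤ} (hf : Primrec f) :
    Primrec fun a => (-f a).toNat := by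
  have h : Primrec fun z : ℤ =>
      if Encodable.encode z % 2 = 0 then 0 else Encodable.encode z / 2 + 1 :=
    Primrec.ite (Primrec.eq.comp (Primrec.nat_mod.comp Primrec.encode (Primrec.const 2))
      (Primrec.const 0)) (Primrec.const 0)
      (Primrec.succ.comp (Primrec.nat_div.comp Primrec.encode (Primrec.const 2)))
  refine Primrec.comp (f := fun z : ℤ => (-z).toNat) (h.of_eq fun z => ?_) hf
  cases z with
  | ofNat n =>
    have : Encodable.encode (Int.ofNat n) = 2 * n := rfl
    rw [this]
    simp
  | negSucc n =>
    have : Encodable.encode (Int.negSucc n) = 2 * n + 1 := rfl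
    rw [this, if_neg (by omega)]
    simp only [Int.neg_negSucc, Int.toNat_natCast]
    omega

end Primrec

namespace PrimrecPred

variable {α β : Type*} [Primcodable α] [Primcodable β]

theorem forall_mem {l : α → List β} {p : α → β → Prop} (hl : Primrec l)
    (hp : PrimrecPred fun z : α × β => p z.1 z.2) : PrimrecPred fun a => ∀ b ∈ l a, p a b :=
  (PrimrecRel.forall_mem_list (R := fun b a => p a b)
    (hp.comp (f := fun z : β × α => (z.2, z.1)) (by fun_prop))).comp hl Primrec.id

theorem exists_mem {l : α → List β} {p : α → β → Prop} (hl : Primrec l)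
    (hp : PrimrecPred fun z : α × β => p z.1 z.2) : PrimrecPred fun a => ∃ b ∈ l a, p a b :=
  (PrimrecRel.exists_mem_list (R := fun b a => p a b)
    (hp.comp (f := fun z : β × α => (z.2, z.1)) (by fun_prop))).comp hl Primrec.id

theorem imp {p q : α → Prop} (hp : PrimrecPred p) (hq : PrimrecPred q) :
    PrimrecPred fun a => p a → q a :=
  (hp.not.or hq).of_eq fun _ => imp_iff_not_or.symm

theorem eq {f g : α → β} (hf : Primrec f) (hg : Primrec g) : PrimrecPred fun a => f a = g a :=
  Primrec.eq.comp hf hg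

theorem lt {f g : α → ℕ} (hf : Primrec f) (hg : Primrec g) : PrimrecPred fun a => f a < g a :=
  Primrec.nat_lt.comp hf hg

theorem mem {f : α → β} {l : α → List β} (hf : Primrec f) (hl : Primrec l) :
    PrimrecPred fun a => f a ∈ l a :=
  (exists_mem (p := fun a b => b = f a) hl (eq (by fun_prop) (by fun_prop))).of_eq fun a => by simp

end PrimrecPred

/-- The function `f` to the rationals is primitive recursive, in the sense that `f a` is
`(p a - n a) / d a` for primitive recursive functions `p`, `n`, `d` to the natural numbers. -/
@[fun_prop]
def RatPrimrec {α : Type*} [Primcodable α] (f : α → ℚ) : Prop :=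
  ∃ p n d : α → ℕ, Primrec p ∧ Primrec n ∧ Primrec d ∧
    ∀ a, 0 < d a ∧ f a = ((p a : ℚ) - n a) / d a

/-- The rational number described by a numerator and a denominator, where the denominator `0` is
read as `1`. -/
def fracVal (c : ℤ × ℕ) : ℚ := c.1 / ((c.2 - 1 + 1 : ℕ) : ℚ)

/-- The inverse of the rational number described by a numerator and a denominator, for a positive
numerator. -/
def fracInv (c : ℤ × ℕ) : ℚ := c.2 / ((c.1.toNat - 1 + 1 : ℕ) : ℚ)

theorem fracVal_num_den (q : ℚ) : fracVal (q.num, q.den) = q := by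
  simp only [fracVal, Nat.sub_add_cancel q.den_pos, Rat.num_div_den]

theorem fracInv_num_den {q : ℚ} (hq : 0 < q) : fracInv (q.num, q.den) = q⁻¹ := by
  have h0 : 0 < q.num := Rat.num_pos.2 hq
  have h : q.num.toNat - 1 + 1 = q.num.toNat := by omega
  have h2 : ((q.num.toNat : ℕ) : ℚ) = q.num := by
    exact_mod_cast congrArg (Int.cast : ℤ → ℚ) (Int.toNat_of_nonneg h0.le)
  rw [fracInv, h, h2, ← inv_div, Rat.num_div_den]

namespace RatPrimrec

variable {α : Type*} [Primcodable α] {f g : α → ℚ}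

@[fun_prop] theorem const (q : ℚ) : RatPrimrec fun _ : α => q := by
  refine ⟨fun _ => q.num.toNat, fun _ => (-q.num).toNat, fun _ => q.den, by fun_prop, by fun_prop,
    by fun_prop, fun _ => ⟨q.den_pos, ?_⟩⟩
  have : ((q.num.toNat : ℤ) : ℚ) - (((-q.num).toNat : ℤ) : ℚ) = q.num := by
    exact_mod_cast congrArg (Int.cast : ℤ → ℚ) (Int.toNat_sub_toNat_neg q.num)
  rw [Int.cast_natCast, Int.cast_natCast] at this
  rw [this, Rat.num_div_den]

@[fun_prop] theorem frac {c : α → ℤ × ℕ} (hc : Primrec c) : RatPrimrec fun a => fracVal (c a) := by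
  refine ⟨fun a => (c a).1.toNat, fun a => (-(c a).1).toNat, fun a => (c a).2 - 1 + 1, by fun_prop,
    by fun_prop, by fun_prop, fun a => ⟨Nat.succ_pos _, ?_⟩⟩
  have : (((c a).1.toNat : ℤ) : ℚ) - (((-(c a).1).toNat : ℤ) : ℚ) = (c a).1 := by
    exact_mod_cast congrArg (Int.cast : ℤ → ℚ) (Int.toNat_sub_toNat_neg (c a).1)
  rw [Int.cast_natCast, Int.cast_natCast] at this
  rw [this]
  rfl

@[fun_prop] theorem fracInv {c : α → ℤ × ℕ} (hc : Primrec c) :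
    RatPrimrec fun a => fracInv (c a) :=
  ⟨fun a => (c a).2, fun _ => 0, fun a => (c a).1.toNat - 1 + 1, by fun_prop,
    by fun_prop, by fun_prop, fun a => ⟨Nat.succ_pos _, by simp [_root_.fracInv]⟩⟩

@[fun_prop] theorem add (hf : RatPrimrec f) (hg : RatPrimrec g) :
    RatPrimrec fun a => f a + g a := by
  obtain ⟨p, n, d, hp, hn, hd, h⟩ := hf
  obtain ⟨p', n', d', hp', hn', hd', h'⟩ := hg
  refine ⟨fun a => p a * d' a + p' a * d a, fun a => n a * d' a + n' a * d a, fun a => d a * d' a,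
    by fun_prop, by fun_prop, by fun_prop, fun a => ⟨Nat.mul_pos (h a).1 (h' a).1, ?_⟩⟩
  have h1 : (d a : ℚ) ≠ 0 := by exact_mod_cast (h a).1.ne'
  have h2 : (d' a : ℚ) ≠ 0 := by exact_mod_cast (h' a).1.ne'
  beta_reduce
  rw [(h a).2, (h' a).2]
  push_cast
  field_simp
  ring

@[fun_prop] theorem mul (hf : RatPrimrec f) (hg : RatPrimrec g) :
    RatPrimrec fun a => f a * g a := by
  obtain ⟨p, n, d, hp, hn, hd, h⟩ := hf
  obtain ⟨p', n', d', hp', hn', hd', h'⟩ := hg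
  refine ⟨fun a => p a * p' a + n a * n' a, fun a => p a * n' a + n a * p' a, fun a => d a * d' a,
    by fun_prop, by fun_prop, by fun_prop, fun a => ⟨Nat.mul_pos (h a).1 (h' a).1, ?_⟩⟩
  have h1 : (d a : ℚ) ≠ 0 := by exact_mod_cast (h a).1.ne'
  have h2 : (d' a : ℚ) ≠ 0 := by exact_mod_cast (h' a).1.ne'
  beta_reduce
  rw [(h a).2, (h' a).2]
  push_cast
  field_simp
  ring

@[fun_prop] theorem neg (hf : RatPrimrec f) : RatPrimrec fun a => -f a := by
  obtain ⟨p, n, d, hp, hn, hd, h⟩ := hf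
  refine ⟨n, p, d, hn, hp, hd, fun a => ⟨(h a).1, ?_⟩⟩
  beta_reduce
  rw [(h a).2, ← neg_div, neg_sub]

@[fun_prop] theorem sub (hf : RatPrimrec f) (hg : RatPrimrec g) :
    RatPrimrec fun a => f a - g a := by
  simpa only [sub_eq_add_neg] using hf.add hg.neg

@[fun_prop] theorem pow {k : α → ℕ} (hf : RatPrimrec f) (hk : Primrec k) :
    RatPrimrec fun a => f a ^ k a := by
  obtain ⟨p, n, d, hp, hn, hd, h⟩ := hf
  -- the triples of numerators and denominators of the powers, by recursion on the exponent
  let F : α → ℕ → ℕ × ℕ × ℕ := fun a j =>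
    Nat.rec (1, 0, 1) (fun _ r =>
      (r.1 * p a + r.2.1 * n a, r.1 * n a + r.2.1 * p a, r.2.2 * d a)) j
  have hval : ∀ a j, 0 < (F a j).2.2 ∧
      f a ^ j = (((F a j).1 : ℚ) - (F a j).2.1) / (F a j).2.2 := by
    intro a j
    induction j with
    | zero => simp [F]
    | succ j ih =>
      have h1 : (d a : ℚ) ≠ 0 := by exact_mod_cast (h a).1.ne'
      have h2 : ((F a j).2.2 : ℚ) ≠ 0 := by exact_mod_cast ih.1.ne'
      have e : F a (j + 1) = ((F a j).1 * p a + (F a j).2.1 * n a,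
        (F a j).1 * n a + (F a j).2.1 * p a, (F a j).2.2 * d a) := rfl
      refine ⟨by rw [e]; exact Nat.mul_pos ih.1 (h a).1, ?_⟩
      rw [pow_succ, ih.2, (h a).2, e]
      push_cast
      field_simp
      ring
  have hF : Primrec fun a => F a (k a) := by
    refine Primrec.nat_rec' (f := k) (g := fun _ => (1, 0, 1))
      (h := fun a z => (z.2.1 * p a + z.2.2.1 * n a, z.2.1 * n a + z.2.2.1 * p a, z.2.2.2 * d a))
      hk (by fun_prop) ?_
    unfold Primrec₂
    fun_prop
  clear_value F
  refine ⟨fun a => (F a (k a)).1, fun a => (F a (k a)).2.1, fun a => (F a (k a)).2.2,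
    Primrec.fst.comp hF, Primrec.fst.comp (Primrec.snd.comp hF),
    Primrec.snd.comp (Primrec.snd.comp hF),
    fun a => hval a (k a)⟩

theorem le (hf : RatPrimrec f) (hg : RatPrimrec g) : PrimrecPred fun a => f a ≤ g a := by
  obtain ⟨p, n, d, hp, hn, hd, h⟩ := hg.sub hf
  refine (Primrec.nat_le.comp hn hp).of_eq fun a => ?_
  have h1 : (0 : ℚ) < d a := by exact_mod_cast (h a).1
  have h2 : g a - f a = _ := (h a).2
  rw [← sub_nonneg (b := f a), h2, le_div_iff₀ h1, zero_mul, sub_nonneg, Nat.cast_le]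

theorem eq (hf : RatPrimrec f) (hg : RatPrimrec g) : PrimrecPred fun a => f a = g a :=
  ((hf.le hg).and (hg.le hf)).of_eq fun _ => le_antisymm_iff.symm

theorem lt (hf : RatPrimrec f) (hg : RatPrimrec g) : PrimrecPred fun a => f a < g a :=
  (hg.le hf).not.of_eq fun _ => not_le

end RatPrimrec

/-- Unbounded search: if every input has a certificate, then some computable function produces an
answer that is supported by a certificate. -/
theorem exists_computable_of_certificates {α β γ : Type*} [Primcodable α] [Primcodable β]
    [Primcodable γ] {p : α → β → γ → Prop} (hp : PrimrecPred fun z : α × β × γ => p z.1 z.2.1 z.2.2)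
    (h : ∀ a, ∃ b c, p a b c) : ∃ f : α → β, Computable f ∧ ∀ a, ∃ c, p a (f a) c := by
  classical
  let g : α → ℕ → Option β := fun a n =>
    (Encodable.decode (α := β × γ) n).bind fun z => if p a z.1 z.2 then some z.1 else none
  have hg : Primrec₂ g := by
    refine Primrec.option_bind (Primrec.decode.comp Primrec.snd) ?_
    refine Primrec.ite (PrimrecPred.comp (f := fun z : (α × ℕ) × β × γ => (z.1.1, z.2.1, z.2.2))
      hp (by fun_prop)) (Primrec.option_some.comp (f := fun b : β => some b)
      (g := fun z : (α × ℕ) × β × γ => z.2.1) (by fun_prop)) (Primrec.const none)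
  have hdom : ∀ a, (Nat.rfindOpt (g a)).Dom := by
    intro a
    obtain ⟨b, c, hbc⟩ := h a
    exact Nat.rfindOpt_dom.2 ⟨Encodable.encode (b, c), b, by simp [g, hbc]⟩
  refine ⟨fun a => (Nat.rfindOpt (g a)).get (hdom a), ?_, fun a => ?_⟩
  · exact (Partrec.rfindOpt hg.to_comp).of_eq fun a => (Part.some_get (hdom a)).symm
  · obtain ⟨n, hn⟩ := Nat.rfindOpt_spec (Part.get_mem (hdom a))
    obtain ⟨z, -, hz⟩ := Option.bind_eq_some_iff.1 hn
    split_ifs at hz with hz'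
    · have e : z.1 = _ := Option.some.inj hz
      exact ⟨z.2, e.subst (motive := fun b => p a b z.2) hz'⟩

/-! ### Certificates and their verification -/

/-- A transition `((q, a, q'), c)` in the description of an automaton. -/
abbrev TransCode : Type := (ℕ × ℕ × ℕ) × (ℤ × ℕ)

/-- An entry `(k, (q, p), V, W)` of a list of potentials: at time `k`, the optimal remaining cost
from the pair of states `(q, p)` is `V x ^ k + W y ^ k` (see `IsPotentialStep`). -/
abbrev PotEntry : Type := ℕ × (ℕ × ℕ) × (ℤ × ℕ) × (ℤ × ℕ)

/-- Every state in the list has a transition to a state in the list. -/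
def LiveList (c : List TransCode) (l : List ℕ) : Prop :=
  ∀ q ∈ l, ∃ t ∈ c, t.1.1 = q ∧ t.1.2.2 ∈ l

/-- A list of states with ranks: every transition from a state of the list leads to a state of the
list with a smaller rank. -/
def DeadList (c : List TransCode) (l : List (ℕ × ℕ)) : Prop :=
  ∀ u ∈ l, ∀ t ∈ c, t.1.1 = u.1 → ∃ v ∈ l, v.1 = t.1.2.2 ∧ v.2 < u.2

/-- A list of ranked pairs of states, of the first and the second automaton: on some letter,
either the first automaton can move into `l` while the second one is stuck, or both can move to a
pair in the list with a smaller rank. -/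
def EscapeList (cA cD : List TransCode) (l : List ℕ) (b : List ((ℕ × ℕ) × ℕ)) : Prop :=
  ∀ u ∈ b, ∃ t ∈ cA, t.1.1 = u.1.1 ∧
    ((t.1.2.2 ∈ l ∧ ∀ t' ∈ cD, ¬(t'.1.1 = u.1.2 ∧ t'.1.2.1 = t.1.2.1)) ∨
      ∃ t' ∈ cD, (t'.1.1 = u.1.2 ∧ t'.1.2.1 = t.1.2.1) ∧
        ∃ v ∈ b, v.1 = (t.1.2.2, t'.1.2.2) ∧ v.2 < u.2)

/-- The coefficient of the first discount in the excess of an edge of cost `c` over the difference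
of the potentials `V` at its source and `V'` at its target. -/
def excess (x c V V' : ℚ) : ℚ := c + x * V' - V

/-- The relation `r` (which is `≤` or `=`) holds between `0` and `a x ^ k + b y ^ k`. In the last
layer `k = K` it has to hold at all later times as well, which is ensured by asking it of the
coefficient of the larger one of `x` and `y`. -/
def RelAfter (r : ℚ → ℚ → Prop) (x y : ℚ) (K k : ℕ) (a b : ℚ) : Prop :=
  r 0 (a * x ^ k + b * y ^ k) ∧ (k = K → (y < x → r 0 a) ∧ (x < y → r 0 b))

/-- The entry `v` follows the entry `u` along the pair of transitions `t`, `t'`, and the potential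
drops by at most (for `r` the relation `≤`), or by exactly (for `=`), the cost of this pair. -/
def IsPotentialStep (r : ℚ → ℚ → Prop) (x y : ℚ) (K : ℕ) (u v : PotEntry) (t t' : TransCode) :
    Prop :=
  v.1 = min (u.1 + 1) K ∧ v.2.1 = (t.1.2.2, t'.1.2.2) ∧
    RelAfter r x y K u.1
      (excess x (fracVal t.2) (fracVal u.2.2.1) (fracVal v.2.2.1))
      (excess y (-fracVal t'.2) (fracVal u.2.2.2) (fracVal v.2.2.2))

/-- The potentials are bounded by the optimal costs: every transition of the first automaton to a
state that is not listed as dead can be answered by the second one, and every such pair of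
transitions leads to an entry that respects the potentials. -/
def LowerPotentials (cA cD : List TransCode) (dead : List (ℕ × ℕ)) (x y : ℚ) (K : ℕ)
    (l : List PotEntry) : Prop :=
  ∀ u ∈ l, ∀ t ∈ cA, t.1.1 = u.2.1.1 → (∃ d ∈ dead, d.1 = t.1.2.2) ∨
    ((∃ t' ∈ cD, t'.1.1 = u.2.1.2 ∧ t'.1.2.1 = t.1.2.1) ∧
      ∀ t' ∈ cD, t'.1.1 = u.2.1.2 ∧ t'.1.2.1 = t.1.2.1 →
        ∃ v ∈ l, IsPotentialStep (· ≤ ·) x y K u v t t')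

/-- The potentials are attained: from every entry some pair of transitions leads to an entry whose
potential differs exactly by the cost. -/
def AttainedPotentials (cA cD : List TransCode) (x y : ℚ) (K : ℕ) (l : List PotEntry) : Prop :=
  ∀ u ∈ l, ∃ t ∈ cA, t.1.1 = u.2.1.1 ∧ ∃ t' ∈ cD, (t'.1.1 = u.2.1.2 ∧ t'.1.2.1 = t.1.2.1) ∧
    ∃ v ∈ l, IsPotentialStep (· = ·) x y K u v t t'

/-- The number `z` is the least potential of a pair of initial states at time `0`. -/
def InitialPotential (iA iD : List ℕ) (dead : List (ℕ × ℕ)) (l : List PotEntry) (z : ℚ) : Prop :=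
  (∀ q ∈ iA, ∀ p ∈ iD, (∃ d ∈ dead, d.1 = q) ∨
    ∃ u ∈ l, u.1 = 0 ∧ u.2.1 = (q, p) ∧ z ≤ fracVal u.2.2.1 + fracVal u.2.2.2) ∧
  ∃ q ∈ iA, ∃ p ∈ iD, ∃ u ∈ l, u.1 = 0 ∧ u.2.1 = (q, p) ∧
    z = fracVal u.2.2.1 + fracVal u.2.2.2

/-- The discount factor is greater than `1`. -/
def FactorOK (c : ℤ × ℕ) : Prop := 0 < c.2 ∧ c.2 < c.1.toNat

/-- Both discount factors are greater than `1`, and the second automaton has an initial state. -/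
def InputOK (i : NDACode × NDACode) : Prop :=
  FactorOK i.1.2.2.1 ∧ FactorOK i.2.2.2.1 ∧ 0 < i.2.2.2.2.1.length

/-- A certificate for an answer: live and ranked dead states of the first automaton, the same for
the second automaton, an escape list, the number of the last layer of potentials, the potentials,
and the value. -/
abbrev Certificate : Type :=
  (List ℕ × List (ℕ × ℕ)) × (List ℕ × List (ℕ × ℕ)) × List ((ℕ × ℕ) × ℕ) × ℕ × List PotEntry ×
    (ℤ × ℕ)

/-- The certificate shows that the first automaton has a run on some word without a run of the
second one. -/
def BotCertificate (i : NDACode × NDACode) (c : Certificate) : Prop :=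
  LiveList i.1.2.2.2.2 c.1.1 ∧ EscapeList i.1.2.2.2.2 i.2.2.2.2.2 c.1.1 c.2.2.1 ∧
    ∃ q ∈ i.1.2.2.2.1, ∃ p ∈ i.2.2.2.2.1, ∃ u ∈ c.2.2.1, u.1 = (q, p)

/-- The certificate shows that the first automaton has no run at all. -/
def NoRunCertificate (i : NDACode × NDACode) (c : Certificate) : Prop :=
  DeadList i.1.2.2.2.2 c.1.2 ∧ ∀ q ∈ i.1.2.2.2.1, ∃ d ∈ c.1.2, d.1 = q

/-- The certificate shows that only the second automaton has runs. -/
def TopCertificate (i : NDACode × NDACode) (c : Certificate) : Prop :=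
  NoRunCertificate i c ∧ LiveList i.2.2.2.2.2 c.2.1.1 ∧ ∃ p ∈ i.2.2.2.2.1, p ∈ c.2.1.1

/-- The certificate shows that neither automaton has a run. -/
def EmptyCertificate (i : NDACode × NDACode) (c : Certificate) : Prop :=
  NoRunCertificate i c ∧ DeadList i.2.2.2.2.2 c.2.1.2 ∧
    ∀ p ∈ i.2.2.2.2.1, ∃ d ∈ c.2.1.2, d.1 = p

/-- The certificate shows that the minimum is the rational number that it contains. -/
def FiniteCertificate (i : NDACode × NDACode) (c : Certificate) : Prop :=
  DeadList i.1.2.2.2.2 c.1.2 ∧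
  LowerPotentials i.1.2.2.2.2 i.2.2.2.2.2 c.1.2 (fracInv i.1.2.2.1) (fracInv i.2.2.2.1)
    c.2.2.2.1 c.2.2.2.2.1 ∧
  AttainedPotentials i.1.2.2.2.2 i.2.2.2.2.2 (fracInv i.1.2.2.1) (fracInv i.2.2.2.1)
    c.2.2.2.1 c.2.2.2.2.1 ∧
  InitialPotential i.1.2.2.2.1 i.2.2.2.2.1 c.1.2 c.2.2.2.2.1 (fracVal c.2.2.2.2.2) ∧
  0 < c.2.2.2.2.2.2

/-- The certificate supports the answer. Inputs without `InputOK` do not describe two automata of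
which the second is deterministic; they are answered by `none`. -/
def Supports (i : NDACode × NDACode) (ans : MinAnswer) (c : Certificate) : Prop :=
  (¬InputOK i ∧ ans = none) ∨ (InputOK i ∧
    ((ans = some (Sum.inl false) ∧ BotCertificate i c) ∨
      (ans = some (Sum.inl true) ∧ TopCertificate i c) ∨
      (ans = none ∧ EmptyCertificate i c) ∨
      (ans = some (Sum.inr c.2.2.2.2.2) ∧ FiniteCertificate i c)))

/-! ### Verifying a certificate is primitive recursive -/

section
variable {α : Type*} [Primcodable α]

open PrimrecPred

theorem primrecPred_liveList {c : α → List TransCode} {l : α → List ℕ} (hc : Primrec c)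
    (hl : Primrec l) : PrimrecPred fun a => LiveList (c a) (l a) :=
  forall_mem hl <| exists_mem (by fun_prop) <|
    (eq (by fun_prop) (by fun_prop)).and (mem (by fun_prop) (by fun_prop))

theorem primrecPred_deadList {c : α → List TransCode} {l : α → List (ℕ × ℕ)} (hc : Primrec c)
    (hl : Primrec l) : PrimrecPred fun a => DeadList (c a) (l a) :=
  forall_mem hl <| forall_mem (by fun_prop) <| imp (eq (by fun_prop) (by fun_prop)) <|
    exists_mem (by fun_prop) <| (eq (by fun_prop) (by fun_prop)).and
      (lt (by fun_prop) (by fun_prop))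

theorem primrecPred_escapeList {cA cD : α → List TransCode} {l : α → List ℕ}
    {b : α → List ((ℕ × ℕ) × ℕ)} (hA : Primrec cA) (hD : Primrec cD) (hl : Primrec l)
    (hb : Primrec b) : PrimrecPred fun a => EscapeList (cA a) (cD a) (l a) (b a) :=
  forall_mem hb <| exists_mem (by fun_prop) <| (eq (by fun_prop) (by fun_prop)).and <|
    ((mem (by fun_prop) (by fun_prop)).and <| forall_mem (by fun_prop) <|
      ((eq (by fun_prop) (by fun_prop)).and (eq (by fun_prop) (by fun_prop))).not).or <|
    exists_mem (by fun_prop) <|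
      ((eq (by fun_prop) (by fun_prop)).and (eq (by fun_prop) (by fun_prop))).and <|
      exists_mem (by fun_prop) <| (eq (by fun_prop) (by fun_prop)).and
        (lt (by fun_prop) (by fun_prop))

theorem primrecPred_relAfter {r : ℚ → ℚ → Prop}
    (hr : ∀ {f : α → ℚ}, RatPrimrec f → PrimrecPred fun a => r 0 (f a)) {x y f g : α → ℚ}
    {K k : α → ℕ} (hx : RatPrimrec x) (hy : RatPrimrec y) (hK : Primrec K) (hk : Primrec k)
    (hf : RatPrimrec f) (hg : RatPrimrec g) :
    PrimrecPred fun a => RelAfter r (x a) (y a) (K a) (k a) (f a) (g a) :=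
  (hr (by fun_prop)).and <| imp (eq hk hK) <|
    (imp (hy.lt hx) (hr hf)).and (imp (hx.lt hy) (hr hg))

theorem primrecPred_isPotentialStep {r : ℚ → ℚ → Prop}
    (hr : ∀ {f : α → ℚ}, RatPrimrec f → PrimrecPred fun a => r 0 (f a)) {x y : α → ℚ} {K : α → ℕ}
    {u v : α → PotEntry} {t t' : α → TransCode} (hx : RatPrimrec x) (hy : RatPrimrec y)
    (hK : Primrec K) (hu : Primrec u) (hv : Primrec v) (ht : Primrec t) (ht' : Primrec t') :
    PrimrecPred fun a => IsPotentialStep r (x a) (y a) (K a) (u a) (v a) (t a) (t' a) := by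
  refine (eq (by fun_prop) (by fun_prop)).and <| (eq (by fun_prop) (by fun_prop)).and <|
    primrecPred_relAfter hr hx hy hK (by fun_prop) ?_ ?_ <;> unfold excess <;> fun_prop

theorem RatPrimrec.comp {β : Type*} [Primcodable β] {f : β → ℚ} {g : α → β} (hf : RatPrimrec f)
    (hg : Primrec g) : RatPrimrec fun a => f (g a) := by
  obtain ⟨p, n, d, hp, hn, hd, h⟩ := hf
  exact ⟨fun a => p (g a), fun a => n (g a), fun a => d (g a), by fun_prop, by fun_prop,
    by fun_prop, fun a => h (g a)⟩

theorem primrecPred_lowerPotentials {cA cD : α → List TransCode} {dead : α → List (ℕ × ℕ)}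
    {x y : α → ℚ} {K : α → ℕ} {l : α → List PotEntry} (hA : Primrec cA) (hD : Primrec cD)
    (hd : Primrec dead) (hx : RatPrimrec x) (hy : RatPrimrec y) (hK : Primrec K)
    (hl : Primrec l) :
    PrimrecPred fun a => LowerPotentials (cA a) (cD a) (dead a) (x a) (y a) (K a) (l a) :=
  forall_mem hl <| forall_mem (by fun_prop) <| imp (eq (by fun_prop) (by fun_prop)) <|
    PrimrecPred.or (exists_mem (by fun_prop) <| eq (by fun_prop) (by fun_prop)) <|
    PrimrecPred.and (exists_mem (by fun_prop) <|
      (eq (by fun_prop) (by fun_prop)).and (eq (by fun_prop) (by fun_prop))) <|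
    forall_mem (by fun_prop) <|
      imp ((eq (by fun_prop) (by fun_prop)).and (eq (by fun_prop) (by fun_prop))) <|
      exists_mem (by fun_prop) <|
        primrecPred_isPotentialStep (fun h => (RatPrimrec.const 0).le h)
          (hx.comp (g := fun z : (((α × PotEntry) × TransCode) × TransCode) × PotEntry =>
            z.1.1.1.1) (by fun_prop))
          (hy.comp (g := fun z : (((α × PotEntry) × TransCode) × TransCode) × PotEntry =>
            z.1.1.1.1) (by fun_prop)) (by fun_prop) (by fun_prop)
          (by fun_prop) (by fun_prop) (by fun_prop)

theorem primrecPred_attainedPotentials {cA cD : α → List TransCode}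
    {x y : α → ℚ} {K : α → ℕ} {l : α → List PotEntry} (hA : Primrec cA) (hD : Primrec cD)
    (hx : RatPrimrec x) (hy : RatPrimrec y) (hK : Primrec K) (hl : Primrec l) :
    PrimrecPred fun a => AttainedPotentials (cA a) (cD a) (x a) (y a) (K a) (l a) :=
  forall_mem hl <| exists_mem (by fun_prop) <| (eq (by fun_prop) (by fun_prop)).and <|
    exists_mem (by fun_prop) <|
      ((eq (by fun_prop) (by fun_prop)).and (eq (by fun_prop) (by fun_prop))).and <|
    exists_mem (by fun_prop) <|
      primrecPred_isPotentialStep (fun h => (RatPrimrec.const 0).eq h)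
        (hx.comp (g := fun z : (((α × PotEntry) × TransCode) × TransCode) × PotEntry =>
          z.1.1.1.1) (by fun_prop))
        (hy.comp (g := fun z : (((α × PotEntry) × TransCode) × TransCode) × PotEntry =>
          z.1.1.1.1) (by fun_prop)) (by fun_prop) (by fun_prop)
        (by fun_prop) (by fun_prop) (by fun_prop)

theorem primrecPred_initialPotential {iA iD : α → List ℕ} {dead : α → List (ℕ × ℕ)}
    {l : α → List PotEntry} {z : α → ℤ × ℕ} (hA : Primrec iA) (hD : Primrec iD)
    (hd : Primrec dead) (hl : Primrec l) (hz : Primrec z) :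
    PrimrecPred fun a => InitialPotential (iA a) (iD a) (dead a) (l a) (fracVal (z a)) :=
  PrimrecPred.and (forall_mem hA <| forall_mem (by fun_prop) <|
    PrimrecPred.or (exists_mem (by fun_prop) <| eq (by fun_prop) (by fun_prop)) <|
    exists_mem (by fun_prop) <| (eq (by fun_prop) (by fun_prop)).and <|
      (eq (by fun_prop) (by fun_prop)).and <| RatPrimrec.le (by fun_prop) (by fun_prop)) <|
  exists_mem hA <| exists_mem (by fun_prop) <| exists_mem (by fun_prop) <|
    (eq (by fun_prop) (by fun_prop)).and <| (eq (by fun_prop) (by fun_prop)).and <|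
      RatPrimrec.eq (by fun_prop) (by fun_prop)

theorem primrecPred_factorOK {c : α → ℤ × ℕ} (hc : Primrec c) :
    PrimrecPred fun a => FactorOK (c a) :=
  (lt (by fun_prop) (by fun_prop)).and (lt (by fun_prop) (by fun_prop))

theorem primrecPred_inputOK {i : α → NDACode × NDACode} (hi : Primrec i) :
    PrimrecPred fun a => InputOK (i a) :=
  (primrecPred_factorOK (by fun_prop)).and <| (primrecPred_factorOK (by fun_prop)).and <|
    lt (by fun_prop) (Primrec.list_length.comp (by fun_prop))

theorem primrecPred_noRunCertificate {i : α → NDACode × NDACode} {c : α → Certificate}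
    (hi : Primrec i) (hc : Primrec c) : PrimrecPred fun a => NoRunCertificate (i a) (c a) :=
  (primrecPred_deadList (by fun_prop) (by fun_prop)).and <| forall_mem (by fun_prop) <|
    exists_mem (by fun_prop) <| eq (by fun_prop) (by fun_prop)

set_option synthInstance.maxSize 1000 in
set_option synthInstance.maxHeartbeats 200000 in
theorem primrecPred_supports :
    PrimrecPred fun z : (NDACode × NDACode) × MinAnswer × Certificate =>
      Supports z.1 z.2.1 z.2.2 := by
  have hok : PrimrecPred fun z : (NDACode × NDACode) × MinAnswer × Certificate => InputOK z.1 :=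
    primrecPred_inputOK (by fun_prop)
  refine (hok.not.and (eq (by fun_prop) (by fun_prop))).or <| hok.and <|
    ((eq (by fun_prop) (by fun_prop)).and ?_).or <|
    ((eq (by fun_prop) (by fun_prop)).and ?_).or <|
    ((eq (by fun_prop) (by fun_prop)).and ?_).or <|
    (eq (by fun_prop) (Primrec.option_some.comp (Primrec.sumInr.comp (by fun_prop)))).and ?_
  · exact (primrecPred_liveList (by fun_prop) (by fun_prop)).and <|
      (primrecPred_escapeList (by fun_prop) (by fun_prop) (by fun_prop) (by fun_prop)).and <|
      exists_mem (by fun_prop) <| exists_mem (by fun_prop) <| exists_mem (by fun_prop) <|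
        eq (by fun_prop) (by fun_prop)
  · exact (primrecPred_noRunCertificate (by fun_prop) (by fun_prop)).and <|
      (primrecPred_liveList (by fun_prop) (by fun_prop)).and <|
      exists_mem (by fun_prop) <| mem (by fun_prop) (by fun_prop)
  · exact (primrecPred_noRunCertificate (by fun_prop) (by fun_prop)).and <|
      (primrecPred_deadList (by fun_prop) (by fun_prop)).and <| forall_mem (by fun_prop) <|
      exists_mem (by fun_prop) <| eq (by fun_prop) (by fun_prop)
  · exact (primrecPred_deadList (by fun_prop) (by fun_prop)).and <|
      (primrecPred_lowerPotentials (by fun_prop) (by fun_prop) (by fun_prop) (by fun_prop)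
        (by fun_prop) (by fun_prop) (by fun_prop)).and <|
      (primrecPred_attainedPotentials (by fun_prop) (by fun_prop) (by fun_prop)
        (by fun_prop) (by fun_prop) (by fun_prop)).and <|
      (primrecPred_initialPotential (by fun_prop) (by fun_prop) (by fun_prop) (by fun_prop)
        (by fun_prop)).and <| lt (by fun_prop) (by fun_prop)

end

/-! ### Optimal potentials of finite graphs -/

section Bellman

variable {N ι : Type*} {x y : ℚ}

theorem nonneg_of_discount_le [Finite N] {τ : N → N} {f : N → ℚ} (hx : 0 < x) (hx1 : x < 1)
    (h : ∀ s, x * f (τ s) ≤ f s) (s : N) : 0 ≤ f s := by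
  have : Nonempty N := ⟨s⟩
  obtain ⟨m, hm⟩ := Finite.exists_min f
  have h1 := mul_le_mul_of_nonneg_left (hm (τ m)) hx.le
  have h2 : 0 ≤ f m := by nlinarith [h m]
  exact h2.trans (hm s)

theorem exists_policy_value [Finite N] (τ : N → N) (u : N → ℚ) (hx : 0 < x) (hx1 : x < 1) :
    ∃ V : N → ℚ, ∀ s, V s = u s + x * V (τ s) := by
  let L : (N → ℚ) →ₗ[ℚ] (N → ℚ) := LinearMap.id - x • LinearMap.funLeft ℚ ℚ τ
  have hL : ∀ V s, L V s = V s - x * V (τ s) := fun V s => rfl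
  -- on a finite-dimensional space it suffices to show that `L` is injective
  have hinj : Function.Injective L := by
    rw [← LinearMap.ker_eq_bot, LinearMap.ker_eq_bot']
    intro V hV
    have h0 : ∀ s, V s = x * V (τ s) := fun s => by
      have := congrFun hV s
      rw [hL] at this
      exact sub_eq_zero.1 this
    have h1 := nonneg_of_discount_le hx hx1 (fun s => (h0 s).ge)
    have h2 := nonneg_of_discount_le (f := fun s => -V s) (τ := τ) hx hx1
      (fun s => by have := h0 s; linarith)
    funext s
    exact le_antisymm (by simpa using h2 s) (h1 s)
  obtain ⟨V, hV⟩ := LinearMap.surjective_of_injective hinj u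
  exact ⟨V, fun s => by rw [← hV, hL]; ring⟩

/-- A finite graph without dead ends has rational optimal discounted costs. They are the costs of
a policy whose total cost over all nodes is least: using an edge that violates the inequality
would improve that policy. -/
theorem exists_bellman [Finite N] [Finite ι] (src tgt : ι → N) (u : ι → ℚ) (hx : 0 < x)
    (hx1 : x < 1) (hout : ∀ s, ∃ e, src e = s) :
    ∃ V : N → ℚ, (∀ e, V (src e) ≤ u e + x * V (tgt e)) ∧
      ∀ s, ∃ e, src e = s ∧ u e + x * V (tgt e) = V s := by
  classical
  have := Fintype.ofFinite N
  choose val hval using fun σ : {σ : N → ι // ∀ s, src (σ s) = s} =>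
    exists_policy_value (fun s => tgt (σ.1 s)) (fun s => u (σ.1 s)) hx hx1
  choose σ₀ hσ₀ using hout
  have : Nonempty {σ : N → ι // ∀ s, src (σ s) = s} := ⟨⟨σ₀, hσ₀⟩⟩
  obtain ⟨σ, hσ⟩ := Finite.exists_min fun σ => ∑ s, val σ s
  refine ⟨val σ, fun e => ?_, fun s => ⟨σ.1 s, σ.2 s, (hval σ s).symm⟩⟩
  by_contra! hlt
  let σ' : {σ : N → ι // ∀ s, src (σ s) = s} := ⟨Function.update σ.1 (src e) e, fun s => by
    by_cases hs : s = src e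
    · subst hs; simp
    · rw [Function.update_of_ne hs, σ.2]⟩
  have hstep : ∀ s, u (σ'.1 s) + x * val σ (tgt (σ'.1 s)) ≤ val σ s := fun s => by
    by_cases hs : s = src e
    · subst hs; simpa [σ'] using hlt.le
    · simp only [σ', Function.update_of_ne hs]
      exact (hval σ s).ge
  have hnn := nonneg_of_discount_le (f := fun s => val σ s - val σ' s)
    (τ := fun s => tgt (σ'.1 s)) hx hx1 (fun s => by
      have h1 := hstep s
      have h2 := hval σ' s
      linarith)
  have hpos : val σ' (src e) < val σ (src e) := by
    have h2 := hval σ' (src e)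
    have h3 : σ'.1 (src e) = e := by simp [σ']
    simp only [h3] at h2
    have h4 := mul_nonneg hx.le (hnn (tgt e))
    linarith
  exact (hσ σ').not_gt
    (Finset.sum_lt_sum (fun s _ => by simpa using hnn s) ⟨src e, Finset.mem_univ _, hpos⟩)

/-- If the first discount dominates, potentials that are optimal at all late times are obtained
lexicographically: first for the cost `u`, then for the cost `v` on the edges that are optimal for
`u`. The other edges lose by a positive gap, which dominates the cost `v` from some time on. -/
theorem exists_lex_potentials [Finite N] [Finite ι] (src tgt : ι → N) (u v : ι → ℚ) (hx : 0 < x)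
    (hx1 : x < 1) (hy : 0 < y) (hyx : y < x) (hout : ∀ s, ∃ e, src e = s) :
    ∃ (K : ℕ) (V W : N → ℚ),
      (∀ e, 0 ≤ excess x (u e) (V (src e)) (V (tgt e)) ∧
        0 ≤ excess x (u e) (V (src e)) (V (tgt e)) * x ^ K +
          excess y (v e) (W (src e)) (W (tgt e)) * y ^ K) ∧
      ∀ s, ∃ e, src e = s ∧ excess x (u e) (V s) (V (tgt e)) = 0 ∧
        excess y (v e) (W s) (W (tgt e)) = 0 := by
  obtain ⟨V, hV, hV'⟩ := exists_bellman src tgt u hx hx1 hout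
  let κ := {e : ι // u e + x * V (tgt e) = V (src e)}
  obtain ⟨W, hW, hW'⟩ := exists_bellman (fun e : κ => src e.1) (fun e : κ => tgt e.1)
    (fun e : κ => v e.1) hy (hyx.trans hx1) (fun s => by
      obtain ⟨e, rfl, he⟩ := hV' s
      exact ⟨⟨e, he⟩, rfl⟩)
  have hK : ∀ e, ∀ᶠ K : ℕ in Filter.atTop,
      0 ≤ excess x (u e) (V (src e)) (V (tgt e)) * x ^ K +
          excess y (v e) (W (src e)) (W (tgt e)) * y ^ K := by
    intro e
    rcases (hV e).eq_or_lt with h | h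
    · refine Filter.Eventually.of_forall fun K => ?_
      have h1 := hW ⟨e, h.symm⟩
      have h2 : excess x (u e) (V (src e)) (V (tgt e)) = 0 := by unfold excess; linarith
      rw [h2, zero_mul, zero_add]
      exact mul_nonneg (by unfold excess; linarith) (by positivity)
    · have h2 : 0 < excess x (u e) (V (src e)) (V (tgt e)) := by unfold excess; linarith
      have hlim : Filter.Tendsto (fun K : ℕ => excess x (u e) (V (src e)) (V (tgt e)) +
          excess y (v e) (W (src e)) (W (tgt e)) * (y / x) ^ K) Filter.atTop
          (nhds (excess x (u e) (V (src e)) (V (tgt e)) +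
            excess y (v e) (W (src e)) (W (tgt e)) * 0)) :=
        ((tendsto_pow_atTop_nhds_zero_of_lt_one (by positivity)
          ((div_lt_one hx).2 hyx)).const_mul _).const_add _
      rw [mul_zero, add_zero] at hlim
      filter_upwards [hlim.eventually (lt_mem_nhds h2)] with K hK
      have h3 := mul_pos hK (pow_pos hx K)
      rw [add_mul, mul_assoc, div_pow, div_mul_cancel₀ _ (pow_pos hx K).ne'] at h3
      exact h3.le
  obtain ⟨K, hK⟩ := (Filter.eventually_all.2 hK).exists
  refine ⟨K, V, W, fun e => ⟨?_, hK e⟩, fun s => ?_⟩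
  · have := hV e
    unfold excess; linarith
  · obtain ⟨e, he, he'⟩ := hW' s
    refine ⟨e.1, he, ?_, ?_⟩
    · have := e.2
      rw [show src e.1 = s from he] at this
      unfold excess; linarith
    · unfold excess; linarith

/-- Potentials that are optimal at all late times, for any pair of discounts. For equal discounts
the two costs are added up. -/
theorem exists_late_potentials [Finite N] [Finite ι] (src tgt : ι → N) (u v : ι → ℚ) (hx : 0 < x)
    (hx1 : x < 1) (hy : 0 < y) (hy1 : y < 1) (hout : ∀ s, ∃ e, src e = s) :
    ∃ (K : ℕ) (V W : N → ℚ),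
      (∀ e, RelAfter (· ≤ ·) x y K K (excess x (u e) (V (src e)) (V (tgt e)))
        (excess y (v e) (W (src e)) (W (tgt e)))) ∧
      ∀ s, ∃ e, src e = s ∧ RelAfter (· = ·) x y K K (excess x (u e) (V s) (V (tgt e)))
        (excess y (v e) (W s) (W (tgt e))) := by
  rcases lt_trichotomy x y with h | rfl | h
  · obtain ⟨K, W, V, h1, h2⟩ := exists_lex_potentials src tgt v u hy hy1 hx h hout
    refine ⟨K, V, W, fun e => ⟨?_, fun _ => ⟨fun h' => (h.not_gt h').elim, fun _ => (h1 e).1⟩⟩,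
      fun s => ?_⟩
    · have := (h1 e).2
      linarith
    · obtain ⟨e, he, ha, hb⟩ := h2 s
      exact ⟨e, he, by rw [ha, hb]; ring, fun _ => ⟨fun _ => hb.symm, fun _ => ha.symm⟩⟩
  · obtain ⟨V, h1, h2⟩ := exists_bellman src tgt (fun e => u e + v e) hx hx1 hout
    refine ⟨0, V, 0, fun e => ⟨?_, fun _ => ⟨fun h => (lt_irrefl _ h).elim,
      fun h => (lt_irrefl _ h).elim⟩⟩, fun s => ?_⟩
    · have := h1 e
      simp only [excess, Pi.zero_apply, pow_zero]
      linarith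
    · obtain ⟨e, he, h3⟩ := h2 s
      refine ⟨e, he, ?_, fun _ => ⟨fun h => (lt_irrefl _ h).elim, fun h => (lt_irrefl _ h).elim⟩⟩
      simp only [excess, Pi.zero_apply, pow_zero]
      linarith
  · obtain ⟨K, V, W, h1, h2⟩ := exists_lex_potentials src tgt u v hx hx1 hy h hout
    refine ⟨K, V, W, fun e => ⟨(h1 e).2, fun _ => ⟨fun _ => (h1 e).1, fun h' => (h.not_gt h').elim⟩⟩,
      fun s => ?_⟩
    obtain ⟨e, he, ha, hb⟩ := h2 s
    exact ⟨e, he, by rw [ha, hb]; ring, fun _ => ⟨fun _ => ha.symm, fun _ => hb.symm⟩⟩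

/-- Backward recursion: optimal costs at time `K` extend to optimal costs at the times before. -/
theorem exists_backward_costs [Finite ι] (src tgt : ι → N) (cost : ℕ → ι → ℚ)
    (hout : ∀ s, ∃ e, src e = s) (K : ℕ) (G : N → ℚ) :
    ∃ F : ℕ → N → ℚ, F K = G ∧ ∀ k < K, (∀ e, F k (src e) ≤ cost k e + F (k + 1) (tgt e)) ∧
      ∀ s, ∃ e, src e = s ∧ F k s = cost k e + F (k + 1) (tgt e) := by
  induction K generalizing G with
  | zero => exact ⟨fun _ => G, rfl, fun k hk => (Nat.not_lt_zero k hk).elim⟩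
  | succ K ih =>
    have hmin : ∀ s, ∃ e, src e = s ∧
        ∀ e', src e' = s → cost K e + G (tgt e) ≤ cost K e' + G (tgt e') := by
      intro s
      obtain ⟨e₀, h₀⟩ := hout s
      obtain ⟨e, he, hm⟩ := Set.exists_min_image {e | src e = s} (fun e => cost K e + G (tgt e))
        (Set.toFinite _) ⟨e₀, h₀⟩
      exact ⟨e, he, hm⟩
    choose best hbest hbest' using hmin
    obtain ⟨F, hF, hF'⟩ := ih fun s => cost K (best s) + G (tgt (best s))
    refine ⟨Function.update F (K + 1) G, by simp, fun k hk => ?_⟩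
    rw [Function.update_of_ne (by omega)]
    rcases (Nat.lt_succ_iff.1 hk).eq_or_lt with rfl | hk'
    · rw [hF, Function.update_self]
      exact ⟨fun e => hbest' _ e rfl, fun s => ⟨best s, hbest s, rfl⟩⟩
    · rw [Function.update_of_ne (by omega)]
      exact hF' k hk'

/-- Optimal potentials in `K + 1` layers, the last of which serves all later times. -/
theorem exists_layered_potentials [Finite N] [Finite ι] (src tgt : ι → N) (u v : ι → ℚ)
    (hx : 0 < x) (hx1 : x < 1) (hy : 0 < y) (hy1 : y < 1) (hout : ∀ s, ∃ e, src e = s) :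
    ∃ (K : ℕ) (V W : ℕ → N → ℚ), ∀ k ≤ K,
      (∀ e, RelAfter (· ≤ ·) x y K k (excess x (u e) (V k (src e)) (V (min (k + 1) K) (tgt e)))
        (excess y (v e) (W k (src e)) (W (min (k + 1) K) (tgt e)))) ∧
      ∀ s, ∃ e, src e = s ∧
        RelAfter (· = ·) x y K k (excess x (u e) (V k s) (V (min (k + 1) K) (tgt e)))
          (excess y (v e) (W k s) (W (min (k + 1) K) (tgt e))) := by
  obtain ⟨K, V, W, h1, h2⟩ := exists_late_potentials src tgt u v hx hx1 hy hy1 hout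
  obtain ⟨F, hFK, hF⟩ := exists_backward_costs src tgt (fun k e => u e * x ^ k + v e * y ^ k) hout K
    (fun s => V s * x ^ K + W s * y ^ K)
  -- before time `K` only the value of the potential matters, so all of it is put into `V'`
  let V' : ℕ → N → ℚ := fun k s => if k = K then V s else F k s / x ^ k
  let W' : ℕ → N → ℚ := fun k s => if k = K then W s else 0
  have hVW : ∀ k s, V' k s * x ^ k + W' k s * y ^ k = F k s := by
    intro k s
    by_cases hk : k = K
    · simp only [V', W', hk, if_true, hFK]
    · simp only [V', W', hk, if_false, zero_mul, add_zero]
      exact div_mul_cancel₀ _ (pow_pos hx k).ne'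
  have hcost : ∀ k e s, k < K →
      excess x (u e) (V' k s) (V' (min (k + 1) K) (tgt e)) * x ^ k +
        excess y (v e) (W' k s) (W' (min (k + 1) K) (tgt e)) * y ^ k =
      u e * x ^ k + v e * y ^ k + F (k + 1) (tgt e) - F k s := by
    intro k e s hk
    rw [Nat.min_eq_left hk, ← hVW k s, ← hVW (k + 1) (tgt e)]
    unfold excess
    ring
  refine ⟨K, V', W', fun k hk => ?_⟩
  rcases hk.eq_or_lt with rfl | hk'
  · simpa only [V', W', Nat.min_eq_right (Nat.le_succ k), if_true] using And.intro h1 h2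
  · refine ⟨fun e => ⟨?_, fun h => (hk'.ne h).elim⟩, fun s => ?_⟩
    · rw [hcost k e _ hk']
      have := (hF k hk').1 e
      linarith
    · obtain ⟨e, he, h⟩ := (hF k hk').2 s
      refine ⟨e, he, ?_, fun h => (hk'.ne h).elim⟩
      rw [hcost k e _ hk']
      linarith

end Bellman

/-! ### Existence of certificates -/

section Existence

/-- Every path from the state has fewer than `k` transitions. -/
def DeadWithin (c : List TransCode) : ℕ → ℕ → Prop
  | 0, _ => False
  | k + 1, q => ∀ t ∈ c, t.1.1 = q → DeadWithin c k t.1.2.2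

/-- There are arbitrarily long paths from the state. -/
def IsLive (c : List TransCode) (q : ℕ) : Prop := ∀ k, ¬DeadWithin c k q

/-- With at most `k` transitions, the first automaton can reach, against some choice of the second
one, a live state while the second automaton gets stuck. -/
def EscapeWithin (cA cD : List TransCode) : ℕ → ℕ → ℕ → Prop
  | 0, _, _ => False
  | k + 1, q, p => ∃ t ∈ cA, t.1.1 = q ∧
      ((IsLive cA t.1.2.2 ∧ ∀ t' ∈ cD, ¬(t'.1.1 = p ∧ t'.1.2.1 = t.1.2.1)) ∨
        ∃ t' ∈ cD, (t'.1.1 = p ∧ t'.1.2.1 = t.1.2.1) ∧ EscapeWithin cA cD k t.1.2.2 t'.1.2.2)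

/-- From this pair of states, however it moves, the second automaton can follow every infinite path
of the first. -/
def IsSafe (cA cD : List TransCode) (q p : ℕ) : Prop := ∀ k, ¬EscapeWithin cA cD k q p

/-- The initial states and the targets of transitions. -/
def stateSet (i : List ℕ) (c : List TransCode) : Finset ℕ :=
  i.toFinset ∪ (c.map fun t => t.1.2.2).toFinset

variable {c cA cD : List TransCode} {i iA iD : List ℕ}

theorem mem_stateSet_of_mem_init {q : ℕ} (h : q ∈ i) : q ∈ stateSet i c := by
  simp [stateSet, h]

theorem target_mem_stateSet {t : TransCode} (h : t ∈ c) : t.1.2.2 ∈ stateSet i c := by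
  simp only [stateSet, Finset.mem_union, List.mem_toFinset, List.mem_map]
  exact Or.inr ⟨t, h, rfl⟩

theorem DeadWithin.succ {k q : ℕ} (h : DeadWithin c k q) : DeadWithin c (k + 1) q := by
  induction k generalizing q with
  | zero => exact h.elim
  | succ k ih => exact fun t ht hq => ih (h t ht hq)

theorem DeadWithin.mono {j k q : ℕ} (hjk : j ≤ k) (h : DeadWithin c j q) : DeadWithin c k q := by
  induction hjk with
  | refl => exact h
  | step _ ih => exact ih.succ

/-- As there are finitely many transitions, a state all of whose successors are dead has only paths
of bounded length. -/
theorem IsLive.exists_step {q : ℕ} (h : IsLive c q) :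
    ∃ t ∈ c, t.1.1 = q ∧ IsLive c t.1.2.2 := by
  by_contra! hcon
  have hev : ∀ t ∈ {t | t ∈ c}, ∀ᶠ k in Filter.atTop, t.1.1 = q → DeadWithin c k t.1.2.2 := by
    intro t ht
    by_cases hq : t.1.1 = q
    · obtain ⟨k, hk⟩ := not_forall_not.1 (hcon t ht hq)
      filter_upwards [Filter.eventually_ge_atTop k] with j hj _ using hk.mono hj
    · exact Filter.Eventually.of_forall fun _ h => (hq h).elim
  obtain ⟨k, hk⟩ := ((Filter.eventually_all_finite c.finite_toSet).2 hev).exists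
  exact h (k + 1) hk

theorem exists_liveList (c : List TransCode) (i : List ℕ) :
    ∃ l, LiveList c l ∧ ∀ q, q ∈ l ↔ q ∈ stateSet i c ∧ IsLive c q := by
  classical
  have hmem : ∀ q, q ∈ ((stateSet i c).filter (IsLive c)).toList ↔
      q ∈ stateSet i c ∧ IsLive c q := by simp
  refine ⟨_, fun q hq => ?_, hmem⟩
  obtain ⟨t, ht, htq, hl⟩ := ((hmem q).1 hq).2.exists_step
  exact ⟨t, ht, htq, (hmem _).2 ⟨target_mem_stateSet ht, hl⟩⟩

theorem exists_deadList (c : List TransCode) (i : List ℕ) :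
    ∃ l, DeadList c l ∧ ∀ q ∈ stateSet i c, ¬IsLive c q → ∃ d ∈ l, d.1 = q := by
  classical
  let r : ℕ → ℕ := fun q => sInf {k | DeadWithin c k q}
  have hmem : ∀ q k, (q, k) ∈ ((stateSet i c).filter (¬IsLive c ·)).toList.map (fun q => (q, r q)) ↔
      q ∈ stateSet i c ∧ ¬IsLive c q ∧ r q = k := by
    simp [and_assoc]
  refine ⟨_, ?_, fun q hq hl => ⟨(q, r q), (hmem _ _).2 ⟨hq, hl, rfl⟩, rfl⟩⟩
  rintro ⟨q, k⟩ hq t ht rfl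
  obtain ⟨-, hl, rfl⟩ := (hmem _ _).1 hq
  have hdead : DeadWithin c (r t.1.1) t.1.1 := Nat.sInf_mem (not_forall_not.1 hl)
  obtain ⟨j, hj⟩ : ∃ j, r t.1.1 = j + 1 :=
    Nat.exists_eq_succ_of_ne_zero fun h0 => by rw [h0] at hdead; exact hdead
  rw [hj] at hdead
  have hd := hdead t ht rfl
  refine ⟨_, (hmem t.1.2.2 _).2 ⟨target_mem_stateSet ht, fun h => h _ hd, rfl⟩, rfl, ?_⟩
  have : r t.1.2.2 ≤ j := Nat.sInf_le hd
  simp only [hj]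
  omega

theorem exists_escapeList (cA cD : List TransCode) (iA iD : List ℕ) {l : List ℕ}
    (hl : ∀ q, q ∈ l ↔ q ∈ stateSet iA cA ∧ IsLive cA q) :
    ∃ b, EscapeList cA cD l b ∧ ∀ q ∈ stateSet iA cA, ∀ p ∈ stateSet iD cD, ¬IsSafe cA cD q p →
      ∃ u ∈ b, u.1 = (q, p) := by
  classical
  let r : ℕ × ℕ → ℕ := fun z => sInf {k | EscapeWithin cA cD k z.1 z.2}
  have hmem : ∀ z k, (z, k) ∈ ((stateSet iA cA ×ˢ stateSet iD cD).filter
      (fun z => ¬IsSafe cA cD z.1 z.2)).toList.map (fun z => (z, r z)) ↔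
      (z.1 ∈ stateSet iA cA ∧ z.2 ∈ stateSet iD cD) ∧ ¬IsSafe cA cD z.1 z.2 ∧ r z = k := by
    rintro ⟨q, p⟩ k
    simp [and_assoc]
  refine ⟨_, ?_, fun q hq p hp hs => ⟨((q, p), r (q, p)), (hmem _ _).2 ⟨⟨hq, hp⟩, hs, rfl⟩, rfl⟩⟩
  rintro ⟨z, k⟩ hz
  obtain ⟨-, hs, rfl⟩ := (hmem _ _).1 hz
  have hesc : EscapeWithin cA cD (r z) z.1 z.2 := Nat.sInf_mem (not_forall_not.1 hs)
  obtain ⟨j, hj⟩ : ∃ j, r z = j + 1 :=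
    Nat.exists_eq_succ_of_ne_zero fun h0 => by rw [h0] at hesc; exact hesc
  rw [hj] at hesc
  obtain ⟨t, ht, htq, h⟩ := hesc
  refine ⟨t, ht, htq, ?_⟩
  rcases h with ⟨hlive, hstuck⟩ | ⟨t', ht', hm, hesc⟩
  · exact Or.inl ⟨(hl _).2 ⟨target_mem_stateSet ht, hlive⟩, hstuck⟩
  · refine Or.inr ⟨t', ht', hm, _, (hmem (t.1.2.2, t'.1.2.2) _).2
      ⟨⟨target_mem_stateSet ht, target_mem_stateSet ht'⟩, fun h => h _ hesc, rfl⟩, rfl, ?_⟩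
    have : r (t.1.2.2, t'.1.2.2) ≤ j := Nat.sInf_le hesc
    simp only [hj]
    omega

theorem IsSafe.step {q p : ℕ} (h : IsSafe cA cD q p) {t : TransCode} (ht : t ∈ cA)
    (htq : t.1.1 = q) (hl : IsLive cA t.1.2.2) :
    (∃ t' ∈ cD, t'.1.1 = p ∧ t'.1.2.1 = t.1.2.1) ∧
      ∀ t' ∈ cD, t'.1.1 = p ∧ t'.1.2.1 = t.1.2.1 → IsSafe cA cD t.1.2.2 t'.1.2.2 := by
  constructor
  · by_contra! hcon
    exact h 1 ⟨t, ht, htq, Or.inl ⟨hl, fun t' ht' hm => hcon t' ht' hm.1 hm.2⟩⟩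
  · exact fun t' ht' hm k hk => h (k + 1) ⟨t, ht, htq, Or.inr ⟨t', ht', hm, hk⟩⟩

/-- If the second automaton can follow all infinite paths of the first, then the optimal potentials
of the product graph, restricted to pairs with a live first component, form a certificate. -/
theorem exists_potentials {dead : List (ℕ × ℕ)} {x y : ℚ} (hx : 0 < x) (hx1 : x < 1) (hy : 0 < y)
    (hy1 : y < 1) (hdead : ∀ q ∈ stateSet iA cA, ¬IsLive cA q → ∃ d ∈ dead, d.1 = q)
    (hA : ∃ q ∈ iA, IsLive cA q) (hD : ∃ p, p ∈ iD)
    (hsafe : ∀ q ∈ iA, ∀ p ∈ iD, IsSafe cA cD q p) :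
    ∃ (K : ℕ) (l : List PotEntry) (z : ℚ), LowerPotentials cA cD dead x y K l ∧
      AttainedPotentials cA cD x y K l ∧ InitialPotential iA iD dead l z := by
  classical
  let good : ℕ × ℕ → Prop := fun z =>
    (z.1 ∈ stateSet iA cA ∧ z.2 ∈ stateSet iD cD) ∧ IsLive cA z.1 ∧ IsSafe cA cD z.1 z.2
  let N := {z : ℕ × ℕ // good z}
  let ι := {e : TransCode × TransCode // (e.1 ∈ cA ∧ e.2 ∈ cD) ∧ e.2.1.2.1 = e.1.1.2.1 ∧
    good (e.1.1.1, e.2.1.1) ∧ good (e.1.1.2.2, e.2.1.2.2)}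
  have : Finite N :=
    ((stateSet iA cA ×ˢ stateSet iD cD).finite_toSet.subset (t := {z | good z})
      fun z hz => by simpa using hz.1).to_subtype
  have : Finite ι :=
    ((cA.finite_toSet.prod cD.finite_toSet).subset (t := {e : TransCode × TransCode |
      (e.1 ∈ cA ∧ e.2 ∈ cD) ∧ e.2.1.2.1 = e.1.1.2.1 ∧ good (e.1.1.1, e.2.1.1) ∧
        good (e.1.1.2.2, e.2.1.2.2)}) fun e he => he.1).to_subtype
  let src : ι → N := fun e => ⟨(e.1.1.1.1, e.1.2.1.1), e.2.2.2.1⟩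
  let tgt : ι → N := fun e => ⟨(e.1.1.1.2.2, e.1.2.1.2.2), e.2.2.2.2⟩
  have hgood : ∀ q p, good (q, p) → ∀ t ∈ cA, t.1.1 = q → IsLive cA t.1.2.2 → ∀ t' ∈ cD,
      t'.1.1 = p ∧ t'.1.2.1 = t.1.2.1 → good (t.1.2.2, t'.1.2.2) := fun q p h t ht hq hl t' ht' hm =>
    ⟨⟨target_mem_stateSet ht, target_mem_stateSet ht'⟩, hl, (h.2.2.step ht hq hl).2 t' ht' hm⟩
  have hout : ∀ s, ∃ e, src e = s := by
    rintro ⟨⟨q, p⟩, h⟩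
    obtain ⟨t, ht, htq, hl⟩ := h.2.1.exists_step
    obtain ⟨t', ht', hm⟩ := (h.2.2.step ht htq hl).1
    have e : (t.1.1, t'.1.1) = (q, p) := Prod.ext htq hm.1
    exact ⟨⟨(t, t'), ⟨ht, ht'⟩, hm.2, e ▸ h, hgood q p h t ht htq hl t' ht' hm⟩, Subtype.ext e⟩
  obtain ⟨K, V, W, hVW⟩ := exists_layered_potentials src tgt (fun e => fracVal e.1.1.2)
    (fun e => -fracVal e.1.2.2) hx hx1 hy hy1 hout
  let entry : ℕ → N → PotEntry := fun k s =>
    (k, s.1, ((V k s).num, (V k s).den), ((W k s).num, (W k s).den))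
  have hfin : (Set.image2 entry (Set.Iic K) Set.univ).Finite :=
    (Set.finite_Iic K).image2 _ Set.finite_univ
  have hmem : ∀ u, u ∈ hfin.toFinset.toList ↔ ∃ k ≤ K, ∃ s, entry k s = u := by
    simp [Set.mem_image2]
  obtain ⟨q₀, hq₀, hl₀⟩ := hA
  obtain ⟨p₀, hp₀⟩ := hD
  have hinit : ∀ q ∈ iA, ∀ p ∈ iD, IsLive cA q → good (q, p) := fun q hq p hp hl =>
    ⟨⟨mem_stateSet_of_mem_init hq, mem_stateSet_of_mem_init hp⟩, hl, hsafe q hq p hp⟩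
  obtain ⟨s, ⟨hsA, hsD⟩, hs⟩ := Set.exists_min_image {s : N | s.1.1 ∈ iA ∧ s.1.2 ∈ iD}
    (fun s => V 0 s + W 0 s) (Set.toFinite _) ⟨⟨(q₀, p₀), hinit _ hq₀ _ hp₀ hl₀⟩, hq₀, hp₀⟩
  refine ⟨K, hfin.toFinset.toList, V 0 s + W 0 s, ?_, ?_, ?_, ?_⟩
  · intro u hu t ht htq
    obtain ⟨k, hk, ⟨⟨q, p⟩, h⟩, rfl⟩ := (hmem u).1 hu
    by_cases hl : IsLive cA t.1.2.2
    · refine Or.inr ⟨(h.2.2.step ht htq hl).1, fun t' ht' hm => ?_⟩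
      have hg := hgood q p h t ht htq hl t' ht' hm
      have e : (t.1.1, t'.1.1) = (q, p) := Prod.ext htq hm.1
      have h1 := (hVW k hk).1 ⟨(t, t'), ⟨ht, ht'⟩, hm.2, e ▸ h, hg⟩
      have h2 : src ⟨(t, t'), ⟨ht, ht'⟩, hm.2, e ▸ h, hg⟩ = ⟨(q, p), h⟩ := Subtype.ext e
      rw [h2] at h1
      refine ⟨entry (min (k + 1) K) ⟨_, hg⟩, (hmem _).2 ⟨_, min_le_right _ _, _, rfl⟩, rfl, rfl, ?_⟩
      simp only [entry, fracVal_num_den]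
      exact h1
    · exact Or.inl (hdead _ (target_mem_stateSet ht) hl)
  · intro u hu
    obtain ⟨k, hk, s, rfl⟩ := (hmem u).1 hu
    obtain ⟨e, rfl, h1⟩ := (hVW k hk).2 s
    refine ⟨e.1.1, e.2.1.1, rfl, e.1.2, e.2.1.2, ⟨rfl, e.2.2.1⟩,
      entry (min (k + 1) K) (tgt e), (hmem _).2 ⟨_, min_le_right _ _, _, rfl⟩, rfl, rfl, ?_⟩
    simp only [entry, fracVal_num_den]
    exact h1
  · intro q hq p hp
    by_cases hl : IsLive cA q
    · refine Or.inr ⟨entry 0 ⟨(q, p), hinit q hq p hp hl⟩, (hmem _).2 ⟨0, K.zero_le, _, rfl⟩, rfl,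
        rfl, ?_⟩
      simp only [entry, fracVal_num_den]
      exact hs ⟨(q, p), hinit q hq p hp hl⟩ ⟨hq, hp⟩
    · exact Or.inl (hdead q (mem_stateSet_of_mem_init hq) hl)
  · refine ⟨s.1.1, hsA, s.1.2, hsD, entry 0 s, (hmem _).2 ⟨0, K.zero_le, _, rfl⟩, rfl, rfl, ?_⟩
    simp only [entry, fracVal_num_den]

theorem FactorOK.fracInv_pos {c : ℤ × ℕ} (h : FactorOK c) : 0 < fracInv c := by
  have := h.1
  unfold fracInv
  positivity

theorem FactorOK.fracInv_lt_one {c : ℤ × ℕ} (h : FactorOK c) : fracInv c < 1 := by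
  unfold fracInv
  rw [div_lt_one (by positivity), Nat.cast_lt]
  have := h.2
  omega

/-- Every input has a certificate, so that the search for one always ends. This includes the inputs
that do not describe automata. -/
theorem exists_supports (i : NDACode × NDACode) : ∃ ans c, Supports i ans c := by
  by_cases hok : InputOK i
  swap
  · exact ⟨none, default, Or.inl ⟨hok, rfl⟩⟩
  obtain ⟨⟨s, n, fA, iA, cA⟩, ⟨s', n', fD, iD, cD⟩⟩ := i
  obtain ⟨lA, hlA, hlA'⟩ := exists_liveList cA iA
  obtain ⟨lD, hlD, hlD'⟩ := exists_liveList cD iD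
  obtain ⟨dA, hdA, hdA'⟩ := exists_deadList cA iA
  obtain ⟨dD, hdD, hdD'⟩ := exists_deadList cD iD
  obtain ⟨b, hb, hb'⟩ := exists_escapeList cA cD iA iD hlA'
  by_cases hA : ∃ q ∈ iA, IsLive cA q
  · by_cases hs : ∀ q ∈ iA, ∀ p ∈ iD, IsSafe cA cD q p
    · obtain ⟨K, l, z, h1, h2, h3⟩ := exists_potentials hok.1.fracInv_pos hok.1.fracInv_lt_one
        hok.2.1.fracInv_pos hok.2.1.fracInv_lt_one hdA' hA (List.exists_mem_of_length_pos hok.2.2) hs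
      refine ⟨_, ((lA, dA), (lD, dD), b, K, l, (z.num, z.den)),
        Or.inr ⟨hok, Or.inr (Or.inr (Or.inr ⟨rfl, hdA, h1, h2, ?_, z.den_pos⟩))⟩⟩
      simpa only [fracVal_num_den] using h3
    · push Not at hs
      obtain ⟨q, hq, p, hp, hs⟩ := hs
      exact ⟨_, ((lA, dA), (lD, dD), b, 0, [], default), Or.inr ⟨hok, Or.inl ⟨rfl, hlA, hb, q, hq, p,
        hp, hb' q (mem_stateSet_of_mem_init hq) p (mem_stateSet_of_mem_init hp) hs⟩⟩⟩
  · push Not at hA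
    have hno : NoRunCertificate ((s, n, fA, iA, cA), (s', n', fD, iD, cD))
        ((lA, dA), (lD, dD), b, 0, [], default) :=
      ⟨hdA, fun q hq => hdA' q (mem_stateSet_of_mem_init hq) (hA q hq)⟩
    by_cases hD : ∃ p ∈ iD, IsLive cD p
    · obtain ⟨p, hp, hl⟩ := hD
      exact ⟨_, _, Or.inr ⟨hok, Or.inr (Or.inl ⟨rfl, hno, hlD, p, hp,
        (hlD' p).2 ⟨mem_stateSet_of_mem_init hp, hl⟩⟩)⟩⟩
    · push Not at hD
      exact ⟨_, _, Or.inr ⟨hok, Or.inr (Or.inr (Or.inl ⟨rfl, hno, hdD,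
        fun p hp => hdD' p (mem_stateSet_of_mem_init hp) (hD p hp)⟩))⟩⟩

end Existence

/-! ### Values of automata -/

open Filter Topology

namespace NDA

variable {α Q P : Type*}

theorem IsDeterministic.run_unique {D : NDA α P} (hD : D.IsDeterministic) {w : ℕ → α}
    {r r' : ℕ → P} (h : D.IsRun w r) (h' : D.IsRun w r') : r = r' := by
  funext k
  induction k with
  | zero => exact Finset.card_le_one.1 hD.1.le _ h.1 _ h'.1
  | succ k ih => exact hD.2 _ _ _ _ (h.2 k) (ih ▸ h'.2 k)

theorem exists_weight_bound [Finite α] [Finite Q] (A : NDA α Q) :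
    ∃ C : ℝ, ∀ q a q', |(((A.weight q a q').getD 0 : ℚ) : ℝ)| ≤ C := by
  obtain ⟨C, hC⟩ := (Set.finite_range fun z : Q × α × Q =>
    |(((A.weight z.1 z.2.1 z.2.2).getD 0 : ℚ) : ℝ)|).bddAbove
  exact ⟨C, fun q a q' => hC ⟨(q, a, q'), rfl⟩⟩

theorem inv_factor_pos (A : NDA α Q) : 0 < A.factor⁻¹ :=
  inv_pos.2 (zero_lt_one.trans A.one_lt_factor)

theorem inv_factor_lt_one (A : NDA α Q) : A.factor⁻¹ < 1 := inv_lt_one_of_one_lt₀ A.one_lt_factor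

theorem norm_term_le (A : NDA α Q) {C : ℝ}
    (hC : ∀ q a q', |(((A.weight q a q').getD 0 : ℚ) : ℝ)| ≤ C) (w : ℕ → α) (r : ℕ → Q) (i : ℕ) :
    ‖(((A.weight (r i) (w i) (r (i + 1))).getD 0 : ℚ) : ℝ) / (A.factor : ℝ) ^ i‖ ≤
      C * ((A.factor⁻¹ : ℚ) : ℝ) ^ i := by
  have h0 : (0 : ℝ) < A.factor := by exact_mod_cast zero_lt_one.trans A.one_lt_factor
  rw [Rat.cast_inv, inv_pow, ← div_eq_mul_inv, norm_div, Real.norm_eq_abs, norm_pow,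
    Real.norm_of_nonneg h0.le]
  exact div_le_div_of_nonneg_right (hC _ _ _) (pow_nonneg h0.le i)

theorem summable_geometric_factor (A : NDA α Q) (C : ℝ) :
    Summable fun i : ℕ => C * ((A.factor⁻¹ : ℚ) : ℝ) ^ i :=
  (summable_geometric_of_lt_one (by exact_mod_cast A.inv_factor_pos.le)
    (by exact_mod_cast A.inv_factor_lt_one)).mul_left C

theorem hasSum_runValue [Finite α] [Finite Q] (A : NDA α Q) (w : ℕ → α) (r : ℕ → Q) :
    HasSum (fun i => (((A.weight (r i) (w i) (r (i + 1))).getD 0 : ℚ) : ℝ) / (A.factor : ℝ) ^ i)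
      (A.runValue w r) := by
  obtain ⟨C, hC⟩ := A.exists_weight_bound
  exact ((A.summable_geometric_factor C).of_norm_bounded (A.norm_term_le hC w r)).hasSum

theorem value_le_runValue (A : NDA α Q) {w : ℕ → α} {r : ℕ → Q} (h : A.IsRun w r) :
    A.value w ≤ A.runValue w r :=
  sInf_le ⟨r, h, rfl⟩

theorem value_eq_top_iff (A : NDA α Q) (w : ℕ → α) : A.value w = ⊤ ↔ ∀ r, ¬A.IsRun w r := by
  constructor
  · intro h r hr
    have := A.value_le_runValue hr
    rw [h, top_le_iff] at this
    exact EReal.coe_ne_top _ this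
  · intro h
    have : {v : EReal | ∃ r, A.IsRun w r ∧ v = (A.runValue w r : EReal)} = ∅ :=
      Set.eq_empty_of_forall_notMem fun v ⟨r, hr, _⟩ => h r hr
    rw [value, this, sInf_empty]

theorem value_eq_runValue {D : NDA α P} (hD : D.IsDeterministic) {w : ℕ → α} {r : ℕ → P}
    (h : D.IsRun w r) : D.value w = D.runValue w r := by
  refine le_antisymm (D.value_le_runValue h) (le_sInf ?_)
  rintro v ⟨r', hr', rfl⟩
  rw [hD.run_unique h hr']

variable {A : NDA α Q} {D : NDA α P}

theorem isLeast_differences_bot {w : ℕ → α} {r : ℕ → Q} (hr : A.IsRun w r)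
    (h : ∀ r', ¬D.IsRun w r') : IsLeast (A.differences D) ⊥ := by
  refine ⟨⟨w, fun hw => (A.value_eq_top_iff w).1 hw.1 r hr, ?_⟩, fun _ _ => bot_le⟩
  rw [(D.value_eq_top_iff w).2 h, sub_eq_add_neg, EReal.neg_top, EReal.add_bot]

theorem top_sub_value {w : ℕ → α} (h : D.value w ≠ ⊤) : ⊤ - D.value w = ⊤ := by
  rw [sub_eq_add_neg]
  exact EReal.top_add_of_ne_bot fun h' => h (by rw [← neg_neg (D.value w), h', EReal.neg_bot])

theorem isLeast_differences_top (hA : ∀ w r, ¬A.IsRun w r) {w : ℕ → α} {r : ℕ → P}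
    (hr : D.IsRun w r) : IsLeast (A.differences D) ⊤ := by
  have htop : ∀ w, A.value w = ⊤ := fun w => (A.value_eq_top_iff w).2 (hA w)
  have hw : D.value w ≠ ⊤ := fun h => (D.value_eq_top_iff w).1 h r hr
  refine ⟨⟨w, fun h => hw h.2, by rw [htop, top_sub_value hw]⟩, ?_⟩
  rintro v ⟨w', h, rfl⟩
  rw [htop, top_sub_value fun h' => h ⟨htop w', h'⟩]

theorem differences_eq_empty (hA : ∀ w r, ¬A.IsRun w r) (hD : ∀ w r, ¬D.IsRun w r) :
    A.differences D = ∅ :=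
  Set.eq_empty_of_forall_notMem fun _ ⟨w, h, _⟩ =>
    h ⟨(A.value_eq_top_iff w).2 (hA w), (D.value_eq_top_iff w).2 (hD w)⟩

/-- A number is the minimum if it bounds the differences of all pairs of runs on a common word and
equals one of them. The infimum over the runs need not be known to be attained in general: on the
word of the latter pair the bound forces it to be. -/
theorem isLeast_differences_coe (hD : D.IsDeterministic) {z : ℝ}
    (hle : ∀ w r, A.IsRun w r → ∃ r', D.IsRun w r' ∧ z ≤ A.runValue w r - D.runValue w r')
    (hex : ∃ w r r', A.IsRun w r ∧ D.IsRun w r' ∧ A.runValue w r - D.runValue w r' = z) :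
    IsLeast (A.differences D) (z : EReal) := by
  have hlower : ∀ v ∈ A.differences D, (z : EReal) ≤ v := by
    rintro v ⟨w, h, rfl⟩
    by_cases hw : A.value w = ⊤
    · rw [hw, top_sub_value fun h' => h ⟨hw, h'⟩]
      exact le_top
    · rw [value_eq_top_iff, not_forall_not] at hw
      obtain ⟨r, hr⟩ := hw
      obtain ⟨r', hr', -⟩ := hle w r hr
      rw [value_eq_runValue hD hr',
        EReal.le_sub_iff_add_le (Or.inl (EReal.coe_ne_bot _)) (Or.inl (EReal.coe_ne_top _))]
      refine le_sInf ?_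
      rintro v ⟨r₁, hr₁, rfl⟩
      obtain ⟨r₂, hr₂, h₂⟩ := hle w r₁ hr₁
      rw [hD.run_unique hr' hr₂, ← EReal.coe_add, EReal.coe_le_coe_iff]
      linarith
  refine ⟨?_, hlower⟩
  obtain ⟨w, r, r', hr, hr', h⟩ := hex
  have hmem : A.value w - D.value w ∈ A.differences D :=
    ⟨w, fun h => (A.value_eq_top_iff w).1 h.1 r hr, rfl⟩
  suffices A.value w - D.value w = z by rwa [this] at hmem
  refine le_antisymm ?_ (hlower _ hmem)
  rw [value_eq_runValue hD hr', ← h, EReal.coe_sub]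
  exact EReal.sub_le_sub (A.value_le_runValue hr) le_rfl

/-! ### Soundness of certificates -/

section Code

variable {s n m : ℕ} {A : NDA (Fin s) (Fin n)} {D : NDA (Fin s) (Fin m)}

theorem mem_code_init {q : ℕ} : q ∈ A.code.2.2.2.1 ↔ ∃ q' ∈ A.init, (q' : ℕ) = q := by
  simp [code, eq_comm]

theorem mem_code_trans {t : TransCode} : t ∈ A.code.2.2.2.2 ↔
    ∃ q a q' c, A.weight q a q' = some c ∧
      t = (((q : ℕ), (a : ℕ), (q' : ℕ)), (c.num, c.den)) := by
  simp only [code, List.mem_flatMap, List.mem_finRange, true_and, List.mem_filterMap,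
    Option.map_eq_some_iff]
  constructor
  · rintro ⟨q, a, q', c, hc, rfl⟩
    exact ⟨q, a, q', c, hc, rfl⟩
  · rintro ⟨q, a, q', c, hc, rfl⟩
    exact ⟨q, a, q', c, hc, rfl⟩

theorem factorOK_code (A : NDA (Fin s) (Fin n)) : FactorOK A.code.2.2.1 := by
  refine ⟨A.factor.den_pos, ?_⟩
  have h : A.factor.den < A.factor.num := by
    have h1 := A.one_lt_factor
    rw [← Rat.num_div_den A.factor, one_lt_div (by exact_mod_cast A.factor.den_pos)] at h1
    exact_mod_cast h1
  change A.factor.den < A.factor.num.toNat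
  omega

theorem inputOK_code (A : NDA (Fin s) (Fin n)) (hD : D.IsDeterministic) :
    InputOK (A.code, D.code) := by
  refine ⟨A.factorOK_code, D.factorOK_code, ?_⟩
  obtain ⟨p, hp⟩ := Finset.card_pos.1 (hD.1 ▸ Nat.one_pos)
  exact List.length_pos_of_mem (mem_code_init.2 ⟨p, hp, rfl⟩)

theorem fracInv_code (A : NDA (Fin s) (Fin n)) : fracInv A.code.2.2.1 = A.factor⁻¹ :=
  fracInv_num_den (zero_lt_one.trans A.one_lt_factor)

theorem not_path_of_deadList {l : List (ℕ × ℕ)} (hl : DeadList A.code.2.2.2.2 l) {w : ℕ → Fin s}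
    {r : ℕ → Fin n} (hr : ∀ i, A.Trans (r i) (w i) (r (i + 1))) (i : ℕ) :
    ¬∃ d ∈ l, d.1 = r i := by
  suffices ∀ k i, ((r i : ℕ), k) ∉ l by
    rintro ⟨⟨_, k⟩, hd, rfl⟩
    exact this k i hd
  intro k
  induction k using Nat.strong_induction_on with
  | _ k ih =>
    intro i hi
    obtain ⟨c, hc⟩ := hr i
    obtain ⟨⟨_, j⟩, hv, rfl, hj⟩ := hl _ hi _ (mem_code_trans.2 ⟨_, _, _, c, hc, rfl⟩) rfl
    exact ih j hj (i + 1) hv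

theorem not_run_of_deadList {l : List (ℕ × ℕ)} (hl : DeadList A.code.2.2.2.2 l)
    (h : ∀ q ∈ A.code.2.2.2.1, ∃ d ∈ l, d.1 = q) (w : ℕ → Fin s) (r : ℕ → Fin n) :
    ¬A.IsRun w r :=
  fun hr => not_path_of_deadList hl hr.2 0 (h _ (mem_code_init.2 ⟨_, hr.1, rfl⟩))

end Code

end NDA

/-- A sequence built by dependent choice, where the invariant and the step depend on the time. -/
theorem exists_seq_of_step {β : Type*} {I : ℕ → β → Prop} {R : ℕ → β → β → Prop} {b : β}
    (hb : I 0 b) (h : ∀ k b, I k b → ∃ b', I (k + 1) b' ∧ R k b b') :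
    ∃ f : ℕ → β, f 0 = b ∧ ∀ k, I k (f k) ∧ R k (f k) (f (k + 1)) := by
  choose g hg using h
  let f : (k : ℕ) → {b // I k b} := fun k =>
    Nat.rec ⟨b, hb⟩ (fun k z => ⟨g k z.1 z.2, (hg k z.1 z.2).1⟩) k
  exact ⟨fun k => (f k).1, rfl, fun k => ⟨(f k).2, (hg k (f k).1 (f k).2).2⟩⟩

/-- Potentials that tend to zero bound the sum of the costs. -/
theorem potential_le_sum {f φ : ℕ → ℝ} {S : ℝ} (hf : HasSum f S) (hφ : Tendsto φ atTop (𝓝 0))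
    (h : ∀ k, φ k ≤ f k + φ (k + 1)) : φ 0 ≤ S := by
  have h1 : ∀ n, φ 0 ≤ ∑ i ∈ Finset.range n, f i + φ n := by
    intro n
    induction n with
    | zero => simp
    | succ n ih =>
      rw [Finset.sum_range_succ]
      linarith [h n]
  have h2 := hf.tendsto_sum_nat.add hφ
  rw [add_zero] at h2
  exact ge_of_tendsto' h2 h1

/-- The conditions at time `k ≤ K` or in the last layer give the inequality at every time. -/
theorem RelAfter.le {x y : ℚ} {K k : ℕ} {a b : ℚ} (hx : 0 < x) (hy : 0 < y)
    (h : RelAfter (· ≤ ·) x y K (min k K) a b) : 0 ≤ a * x ^ k + b * y ^ k := by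
  obtain ⟨h0, h1⟩ := h
  rcases le_total k K with hk | hk
  · rwa [min_eq_left hk] at h0
  · rw [min_eq_right hk] at h0 h1
    obtain ⟨j, rfl⟩ := Nat.exists_eq_add_of_le hk
    have hxj := pow_pos hx j
    have hyj := pow_pos hy j
    have hxK := pow_pos hx K
    have hyK := pow_pos hy K
    -- the coefficient of the larger discount is nonnegative, and its power decreases more slowly
    rcases lt_trichotomy x y with hxy | rfl | hxy
    · have hb := (h1 rfl).2 hxy
      have h2 := mul_le_mul_of_nonneg_left (pow_le_pow_left₀ hx.le hxy.le j)
        (mul_nonneg hb hyK.le)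
      have h3 := mul_nonneg h0 hxj.le
      rw [pow_add, pow_add]
      nlinarith
    · rw [pow_add, ← mul_assoc, ← mul_assoc, ← add_mul]
      exact mul_nonneg h0 hxj.le
    · have ha := (h1 rfl).1 hxy
      have h2 := mul_le_mul_of_nonneg_left (pow_le_pow_left₀ hy.le hxy.le j)
        (mul_nonneg ha hxK.le)
      have h3 := mul_nonneg h0 hyj.le
      rw [pow_add, pow_add]
      nlinarith

theorem RelAfter.eq {x y : ℚ} {K k : ℕ} {a b : ℚ} (hx : 0 < x) (hy : 0 < y)
    (h : RelAfter (· = ·) x y K (min k K) a b) : 0 = a * x ^ k + b * y ^ k := by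
  refine le_antisymm (RelAfter.le hx hy (K := K) ⟨h.1.le, fun hk =>
    ⟨fun hl => ((h.2 hk).1 hl).le, fun hl => ((h.2 hk).2 hl).le⟩⟩) ?_
  have := RelAfter.le (a := -a) (b := -b) (k := k) hx hy (K := K)
    ⟨by have := h.1; beta_reduce; linarith, fun hk =>
      ⟨fun hl => by have := (h.2 hk).1 hl; beta_reduce; linarith,
        fun hl => by have := (h.2 hk).2 hl; beta_reduce; linarith⟩⟩
  linarith

namespace NDA

variable {s n m : ℕ} {A : NDA (Fin s) (Fin n)} {D : NDA (Fin s) (Fin m)}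

theorem exists_path_of_liveList {l : List ℕ} (hl : LiveList A.code.2.2.2.2 l) {q : Fin n}
    (hq : (q : ℕ) ∈ l) :
    ∃ (w : ℕ → Fin s) (r : ℕ → Fin n), r 0 = q ∧ ∀ i, A.Trans (r i) (w i) (r (i + 1)) := by
  obtain ⟨r, hr, h⟩ := exists_seq_of_step (I := fun _ (q : Fin n) => (q : ℕ) ∈ l)
    (R := fun _ q q' => ∃ a, A.Trans q a q') (b := q) hq (by
      intro _ q hq
      obtain ⟨t, ht, h1, h2⟩ := hl q hq
      obtain ⟨q₁, a, q', c, hc, rfl⟩ := mem_code_trans.1 ht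
      obtain rfl : q₁ = q := Fin.ext h1
      exact ⟨q', h2, a, c, hc⟩)
  choose w hw using fun i => (h i).2
  exact ⟨w, r, hr, hw⟩

/-- A certified escape gives a word and a path of the first automaton on it, while the second one,
being deterministic, cannot avoid getting stuck. -/
theorem exists_escape {l : List ℕ} {b : List ((ℕ × ℕ) × ℕ)} (hD : D.IsDeterministic)
    (hl : LiveList A.code.2.2.2.2 l) (hb : EscapeList A.code.2.2.2.2 D.code.2.2.2.2 l b) (k : ℕ)
    (q : Fin n) (p : Fin m) (h : (((q : ℕ), (p : ℕ)), k) ∈ b) :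
    ∃ (w : ℕ → Fin s) (r : ℕ → Fin n), r 0 = q ∧ (∀ i, A.Trans (r i) (w i) (r (i + 1))) ∧
      ∀ r' : ℕ → Fin m, r' 0 = p → ¬∀ i, D.Trans (r' i) (w i) (r' (i + 1)) := by
  induction k using Nat.strong_induction_on generalizing q p with
  | _ k ih =>
    obtain ⟨t, ht, h1, h2⟩ := hb _ h
    obtain ⟨q₁, a, q', c, hc, rfl⟩ := mem_code_trans.1 ht
    obtain rfl : q₁ = q := Fin.ext h1
    rcases h2 with ⟨hlive, hstuck⟩ | ⟨t', ht', ⟨hp, ha⟩, ⟨_, j⟩, hv, rfl, hj⟩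
    · obtain ⟨w, r, hr, hw⟩ := exists_path_of_liveList hl hlive
      refine ⟨fun | 0 => a | i + 1 => w i, fun | 0 => q₁ | i + 1 => r i, rfl, ?_, ?_⟩
      · rintro (_ | i)
        · exact ⟨c, by simpa [hr] using hc⟩
        · exact hw i
      · intro r' hr' hpath
        obtain ⟨d, hd⟩ := hpath 0
        exact hstuck _ (mem_code_trans.2 ⟨_, _, _, d, hd, rfl⟩) ⟨by rw [hr'], rfl⟩
    · obtain ⟨p₁, a', p', d, hd, rfl⟩ := mem_code_trans.1 ht'
      obtain rfl : p₁ = p := Fin.ext hp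
      obtain rfl : a' = a := Fin.ext ha
      obtain ⟨w, r, hr, hw, hw'⟩ := ih j hj q' p' hv
      refine ⟨fun | 0 => a' | i + 1 => w i, fun | 0 => q₁ | i + 1 => r i, rfl, ?_, ?_⟩
      · rintro (_ | i)
        · exact ⟨c, by simpa [hr] using hc⟩
        · exact hw i
      · intro r' hr' hpath
        have h0 := hpath 0
        rw [hr'] at h0
        exact hw' (fun i => r' (i + 1)) (hD.2 _ _ _ _ h0 ⟨d, hd⟩) fun i => hpath (i + 1)

end NDA

namespace NDA

variable {s n m : ℕ} {A : NDA (Fin s) (Fin n)} {D : NDA (Fin s) (Fin m)}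

/-! ### Soundness of potentials -/

theorem tendsto_mul_pow_of_mem {β : Type*} {l : List β} {u : ℕ → β} (hu : ∀ k, u k ∈ l)
    (V : β → ℚ) {x : ℚ} (hx : 0 < x) (hx1 : x < 1) :
    Tendsto (fun k => ((V (u k) * x ^ k : ℚ) : ℝ)) atTop (𝓝 0) := by
  obtain ⟨C, hC⟩ := (l.finite_toSet.image fun b => |((V b : ℚ) : ℝ)|).bddAbove
  have hlim : Tendsto (fun k : ℕ => C * (x : ℝ) ^ k) atTop (𝓝 (C * 0)) :=
    (tendsto_pow_atTop_nhds_zero_of_lt_one (by exact_mod_cast hx.le)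
      (by exact_mod_cast hx1)).const_mul C
  rw [mul_zero] at hlim
  refine squeeze_zero_norm (fun k => ?_) hlim
  have hx' : (0 : ℝ) < (x : ℝ) := by exact_mod_cast hx
  rw [Rat.cast_mul, Rat.cast_pow, norm_mul, norm_pow, Real.norm_of_nonneg hx'.le]
  exact mul_le_mul_of_nonneg_right (hC ⟨u k, hu k, rfl⟩) (pow_nonneg hx'.le k)

/-- The potential of an entry at time `k`. -/
def potentialAt (A : NDA (Fin s) (Fin n)) (D : NDA (Fin s) (Fin m)) (u : PotEntry) (k : ℕ) : ℝ :=
  ((fracVal u.2.2.1 * A.factor⁻¹ ^ k : ℚ) : ℝ) + ((fracVal u.2.2.2 * D.factor⁻¹ ^ k : ℚ) : ℝ)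

theorem tendsto_potentialAt {l : List PotEntry} {u : ℕ → PotEntry} (hu : ∀ k, u k ∈ l) :
    Tendsto (fun k => potentialAt A D (u k) k) atTop (𝓝 0) := by
  have h := (tendsto_mul_pow_of_mem hu (fun u => fracVal u.2.2.1) A.inv_factor_pos
    A.inv_factor_lt_one).add (tendsto_mul_pow_of_mem hu (fun u => fracVal u.2.2.2)
      D.inv_factor_pos D.inv_factor_lt_one)
  rwa [add_zero] at h

/-- The cost at time `k` of a pair of transitions. -/
noncomputable def stepCost (A : NDA (Fin s) (Fin n)) (D : NDA (Fin s) (Fin m)) (w : ℕ → Fin s)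
    (r : ℕ → Fin n) (r' : ℕ → Fin m) (k : ℕ) : ℝ :=
  (((A.weight (r k) (w k) (r (k + 1))).getD 0 : ℚ) : ℝ) / (A.factor : ℝ) ^ k -
    (((D.weight (r' k) (w k) (r' (k + 1))).getD 0 : ℚ) : ℝ) / (D.factor : ℝ) ^ k

theorem hasSum_stepCost (A : NDA (Fin s) (Fin n)) (D : NDA (Fin s) (Fin m)) (w : ℕ → Fin s)
    (r : ℕ → Fin n) (r' : ℕ → Fin m) :
    HasSum (stepCost A D w r r') (A.runValue w r - D.runValue w r') :=
  (A.hasSum_runValue w r).sub (D.hasSum_runValue w r')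

theorem stepCost_add_potentialAt_sub {w : ℕ → Fin s} {r : ℕ → Fin n} {r' : ℕ → Fin m} {k : ℕ}
    {c d : ℚ} (hc : A.weight (r k) (w k) (r (k + 1)) = some c)
    (hd : D.weight (r' k) (w k) (r' (k + 1)) = some d) (u v : PotEntry) :
    stepCost A D w r r' k + potentialAt A D v (k + 1) - potentialAt A D u k =
      ((excess A.factor⁻¹ c (fracVal u.2.2.1) (fracVal v.2.2.1) * A.factor⁻¹ ^ k +
        excess D.factor⁻¹ (-d) (fracVal u.2.2.2) (fracVal v.2.2.2) * D.factor⁻¹ ^ k : ℚ) : ℝ) := by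
  simp only [stepCost, potentialAt, excess, hc, hd, Option.getD_some, div_eq_mul_inv, ← inv_pow,
    pow_succ]
  push_cast
  ring

theorem min_succ_min (k K : ℕ) : min (min k K + 1) K = min (k + 1) K := by omega

section Finite

variable {dead : List (ℕ × ℕ)} {K : ℕ} {l : List PotEntry} {z : ℚ}

/-- Along every run of the first automaton there are a run of the second one and a sequence of
potentials that are never above the remaining cost. -/
theorem exists_run_of_lowerPotentials (hdead : DeadList A.code.2.2.2.2 dead)
    (hl : LowerPotentials A.code.2.2.2.2 D.code.2.2.2.2 dead A.factor⁻¹ D.factor⁻¹ K l)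
    {w : ℕ → Fin s} {r : ℕ → Fin n} (hr : A.IsRun w r) {p : Fin m} (hp : p ∈ D.init)
    {u : PotEntry} (hu : u ∈ l) (hu0 : u.1 = 0) (hup : u.2.1 = ((r 0 : ℕ), (p : ℕ)))
    (hz : z ≤ fracVal u.2.2.1 + fracVal u.2.2.2) :
    ∃ r', D.IsRun w r' ∧ (z : ℝ) ≤ A.runValue w r - D.runValue w r' := by
  obtain ⟨f, hf0, hf⟩ := exists_seq_of_step
    (I := fun k (b : Fin m × PotEntry) =>
      b.2 ∈ l ∧ b.2.1 = min k K ∧ b.2.2.1 = ((r k : ℕ), (b.1 : ℕ)))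
    (R := fun k b b' => ∃ c d, A.weight (r k) (w k) (r (k + 1)) = some c ∧
      D.weight b.1 (w k) b'.1 = some d ∧
      0 ≤ excess A.factor⁻¹ c (fracVal b.2.2.2.1) (fracVal b'.2.2.2.1) * A.factor⁻¹ ^ k +
        excess D.factor⁻¹ (-d) (fracVal b.2.2.2.2) (fracVal b'.2.2.2.2) * D.factor⁻¹ ^ k)
    (b := (p, u)) ⟨hu, by simp [hu0], hup⟩ (by
      rintro k ⟨p, u⟩ ⟨hu, huk, hup⟩
      dsimp only at hu huk hup
      obtain ⟨c, hc⟩ := hr.2 k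
      rcases hl u hu _ (mem_code_trans.2 ⟨_, _, _, c, hc, rfl⟩) (by rw [hup]) with h | ⟨h1, h2⟩
      · exact (not_path_of_deadList hdead hr.2 (k + 1) h).elim
      · obtain ⟨t', ht', hm⟩ := h1
        obtain ⟨v, hv, hvk, hvp, hrel⟩ := h2 t' ht' hm
        obtain ⟨p₁, a, p', d, hd, rfl⟩ := mem_code_trans.1 ht'
        rw [hup] at hm
        obtain rfl : p₁ = p := Fin.ext hm.1
        obtain rfl : a = w k := Fin.ext hm.2
        simp only [huk, fracVal_num_den] at hrel hvk
        exact ⟨(p', v), ⟨hv, hvk.trans (min_succ_min k K), hvp⟩, c, d, hc, hd,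
          hrel.le A.inv_factor_pos D.inv_factor_pos⟩)
  refine ⟨fun k => (f k).1, ⟨by beta_reduce; rw [hf0]; exact hp, fun k => ?_⟩, ?_⟩
  · obtain ⟨c, d, -, hd, -⟩ := (hf k).2
    exact ⟨d, hd⟩
  · have h := potential_le_sum (hasSum_stepCost A D w r fun k => (f k).1)
      (tendsto_potentialAt (A := A) (D := D) fun k => (hf k).1.1) (fun k => by
        obtain ⟨c, d, hc, hd, h⟩ := (hf k).2
        have h1 := stepCost_add_potentialAt_sub (r' := fun k => (f k).1) hc hd (f k).2 (f (k + 1)).2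
        have h2 : (0 : ℝ) ≤ ((_ : ℚ) : ℝ) := Rat.cast_nonneg.2 h
        linarith)
    refine le_trans ?_ h
    rw [hf0, potentialAt, pow_zero, pow_zero, mul_one, mul_one, ← Rat.cast_add]
    exact Rat.cast_le.2 hz

/-- Following the transitions that attain the potentials gives two runs on a common word whose
difference is the initial potential. -/
theorem exists_runs_of_attainedPotentials
    (hl : AttainedPotentials A.code.2.2.2.2 D.code.2.2.2.2 A.factor⁻¹ D.factor⁻¹ K l)
    {q : Fin n} (hq : q ∈ A.init) {p : Fin m} (hp : p ∈ D.init)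
    {u : PotEntry} (hu : u ∈ l) (hu0 : u.1 = 0) (hup : u.2.1 = ((q : ℕ), (p : ℕ))) :
    ∃ w r r', A.IsRun w r ∧ D.IsRun w r' ∧ A.runValue w r - D.runValue w r' =
      ((fracVal u.2.2.1 + fracVal u.2.2.2 : ℚ) : ℝ) := by
  obtain ⟨f, hf0, hf⟩ := exists_seq_of_step
    (I := fun k (b : (Fin n × Fin m) × PotEntry) =>
      b.2 ∈ l ∧ b.2.1 = min k K ∧ b.2.2.1 = ((b.1.1 : ℕ), (b.1.2 : ℕ)))
    (R := fun k b b' => ∃ a c d, A.weight b.1.1 a b'.1.1 = some c ∧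
      D.weight b.1.2 a b'.1.2 = some d ∧
      0 = excess A.factor⁻¹ c (fracVal b.2.2.2.1) (fracVal b'.2.2.2.1) * A.factor⁻¹ ^ k +
        excess D.factor⁻¹ (-d) (fracVal b.2.2.2.2) (fracVal b'.2.2.2.2) * D.factor⁻¹ ^ k)
    (b := ((q, p), u)) ⟨hu, by simp [hu0], hup⟩ (by
      rintro k ⟨⟨q, p⟩, u⟩ ⟨hu, huk, hup⟩
      dsimp only at hu huk hup
      obtain ⟨t, ht, htq, t', ht', hm, v, hv, hvk, hvp, hrel⟩ := hl u hu
      obtain ⟨q₁, a, q', c, hc, rfl⟩ := mem_code_trans.1 ht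
      obtain ⟨p₁, a', p', d, hd, rfl⟩ := mem_code_trans.1 ht'
      rw [hup] at htq hm
      obtain rfl : q₁ = q := Fin.ext htq
      obtain rfl : p₁ = p := Fin.ext hm.1
      obtain rfl : a' = a := Fin.ext hm.2
      simp only [huk, fracVal_num_den] at hrel hvk
      exact ⟨((q', p'), v), ⟨hv, hvk.trans (min_succ_min k K), hvp⟩, a', c, d, hc, hd,
        hrel.eq A.inv_factor_pos D.inv_factor_pos⟩)
  choose w c d hc hd h using fun k => (hf k).2
  have hstep := fun k => (stepCost_add_potentialAt_sub (r := fun k => (f k).1.1)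
    (r' := fun k => (f k).1.2) (hc k) (hd k) (f k).2 (f (k + 1)).2).trans
      (congrArg (Rat.cast : ℚ → ℝ) (h k).symm)
  refine ⟨w, fun k => (f k).1.1, fun k => (f k).1.2,
    ⟨by beta_reduce; rw [hf0]; exact hq, fun k => ⟨c k, hc k⟩⟩,
    ⟨by beta_reduce; rw [hf0]; exact hp, fun k => ⟨d k, hd k⟩⟩, ?_⟩
  have hsum := hasSum_stepCost A D w (fun k => (f k).1.1) fun k => (f k).1.2
  have hlim : Tendsto (fun k => potentialAt A D (f k).2 k) atTop (𝓝 0) :=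
    tendsto_potentialAt fun k => (hf k).1.1
  have h1 := potential_le_sum hsum hlim (fun k => by
    have := hstep k
    rw [Rat.cast_zero] at this
    linarith)
  have h2 := potential_le_sum hsum.neg (by simpa using hlim.neg) (fun k => by
    have := hstep k
    rw [Rat.cast_zero] at this
    linarith)
  have h0 : potentialAt A D (f 0).2 0 = ((fracVal u.2.2.1 + fracVal u.2.2.2 : ℚ) : ℝ) := by
    rw [hf0, potentialAt, pow_zero, pow_zero, mul_one, mul_one, ← Rat.cast_add]
  linarith

theorem isLeast_of_finiteCertificate (hD : D.IsDeterministic) {c : Certificate}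
    (hc : FiniteCertificate (A.code, D.code) c) :
    IsLeast (A.differences D) (((fracVal c.2.2.2.2.2 : ℚ) : ℝ) : EReal) := by
  obtain ⟨hdead, hlow, hatt, ⟨hini, q, hq, p, hp, u, hu, hu0, hup, hz⟩, -⟩ := hc
  simp only [fracInv_code] at hlow hatt
  refine isLeast_differences_coe hD (fun w r hr => ?_) ?_
  · obtain ⟨p, hp⟩ := Finset.card_pos.1 (hD.1 ▸ Nat.one_pos)
    rcases hini (r 0) (mem_code_init.2 ⟨_, hr.1, rfl⟩) p (mem_code_init.2 ⟨_, hp, rfl⟩) with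
      h | ⟨u, hu, hu0, hup, hz⟩
    · exact (not_path_of_deadList hdead hr.2 0 h).elim
    · exact exists_run_of_lowerPotentials hdead hlow hr hp hu hu0 hup hz
  · obtain ⟨q, hqi, rfl⟩ := mem_code_init.1 hq
    obtain ⟨p, hpi, rfl⟩ := mem_code_init.1 hp
    obtain ⟨w, r, r', hr, hr', h⟩ := exists_runs_of_attainedPotentials hatt hqi hpi hu hu0 hup
    exact ⟨w, r, r', hr, hr', by rw [h, hz]⟩

end Finite

/-- Certificates are sound: a supported answer describes the minimum of the differences. -/
theorem isMinAnswer_of_supports (hD : D.IsDeterministic) {ans : MinAnswer} {c : Certificate}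
    (h : Supports (A.code, D.code) ans c) : IsMinAnswer (A.differences D) ans := by
  rcases h with ⟨h, -⟩ | ⟨-, ⟨rfl, hl, hb, q, hq, p, hp, ⟨_, k⟩, hu, rfl⟩ |
    ⟨rfl, ⟨hdead, hini⟩, hl, p, hp, hpl⟩ | ⟨rfl, ⟨hdead, hini⟩, hdead', hini'⟩ | ⟨rfl, hc⟩⟩
  · exact (h (inputOK_code A hD)).elim
  · obtain ⟨q, hqi, rfl⟩ := mem_code_init.1 hq
    obtain ⟨p, hpi, rfl⟩ := mem_code_init.1 hp
    obtain ⟨w, r, rfl, hr, hno⟩ := exists_escape hD hl hb k q p hu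
    exact isLeast_differences_bot ⟨hqi, hr⟩ fun r' hr' =>
      hno r' (Finset.card_le_one.1 hD.1.le _ hr'.1 _ hpi) hr'.2
  · obtain ⟨p, hpi, rfl⟩ := mem_code_init.1 hp
    obtain ⟨w, r, rfl, hr⟩ := exists_path_of_liveList hl hpl
    exact isLeast_differences_top (not_run_of_deadList hdead hini) ⟨hpi, hr⟩
  · exact differences_eq_empty (not_run_of_deadList hdead hini)
      (not_run_of_deadList hdead' hini')
  · refine ⟨hc.2.2.2.2, ?_⟩
    have h := isLeast_of_finiteCertificate hD hc
    have e : c.2.2.2.2.2.2 - 1 + 1 = c.2.2.2.2.2.2 := Nat.sub_add_cancel hc.2.2.2.2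
    rw [fracVal, e] at h
    exact_mod_cast h

end NDA

set_option synthInstance.maxSize 1000 in
set_option synthInstance.maxHeartbeats 200000 in
theorem mainTheorem7 :
    ∃ f : NDACode × NDACode → MinAnswer, Computable f ∧
      ∀ (s n m : ℕ) (A : NDA (Fin s) (Fin n)) (D : NDA (Fin s) (Fin m)),
        D.IsDeterministic → IsMinAnswer (A.differences D) (f (A.code, D.code)) := by
  obtain ⟨f, hf, h⟩ := exists_computable_of_certificates primrecPred_supports exists_supports
  refine ⟨f, hf, fun s n m A D hD => ?_⟩
  obtain ⟨c, hc⟩ := h (A.code, D.code)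
  exact NDA.isMinAnswer_of_supports hD hc
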